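/- All Banach lattices are real, and "operator" means bounded linear map; an operator $T$ between ordered spaces is positive if $Tx\ge 0$ for all $x\ge 0$. For elements $x_1,\dots,x_n$ of a Banach lattice and $1\le r<\infty$, $\bigl(\sum_k|x_k|^r\bigr)^{1/r}$ denotes the usual element given by the homogeneous functional calculus, i.e. the least upper bound of all $\sum_k a_kx_k$ with $(a_k)$ in the closed unit ball of $\ell_{r'}^n$, $\frac1r+\frac1{r'}=1$. An operator $T:X\to F$ from a Banach lattice $X$ into a Banach space $F$ is called $r$-concave if there is $c\ge0$ such that $\bigl(\sum_k\|Tx_k\|_F^r\bigr)^{1/r}\le c\,\bigl\|\bigl(\sum_k|x_k|^r\bigr)^{1/r}\bigr\|_X$ for all finitely many $x_1,\dots,x_n\in X$; a Banach lattice is $r$-concave if its identity operator is. Let $\mu$ be a $\sigma$-finite complete measure on a measurable space $\Omega$ and let $L_0(\mu)$ be the space of $\mu$-a.e. classes of real measurable functions on $\Omega$. A Banach function space $X(\mu)$ is a linear subspace of $L_0(\mu)$ with a complete norm such that: (I) if $x\in L_0(\mu)$, $y\in X$ and $|x|\le|y|$, then $x\in X$ and $\|x\|_X\le\|y\|_X$;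 (II) every measurable set on which all functions of $X$ vanish a.e. is a $\mu$-null set; (III) if $0\le x_n\in X$, $x\in X$ and $x_n\uparrow x$ a.e., then $\|x_n\|_X\to\|x\|_X$. It is $r$-convex if there is $c\ge0$ such that $\bigl\|\bigl(\sum_k|x_k|^r\bigr)^{1/r}\bigr\|_X\le c\bigl(\sum_k\|x_k\|_X^r\bigr)^{1/r}$ for all finitely many $x_1,\dots,x_n\in X$. Its $r$-th power is the vector space $X^r:=\{x\in L_0(\mu): |x|^{1/r}\in X\}$. **Corollary 7.** Let $1\le r<\infty$ and let $F$ be a Banach lattice. Then the following are equivalent: (1) $F$ is $r$-concave. (2) Every positive operator $T:X\to F$, $X$ a Banach lattice, is $r$-concave. (3) For every $r$-convex Banach function space $X(\mu)$ over a $\sigma$-finite complete measure $\mu$ and every positive operator $T:X(\mu)\to F$ there is a linear functional $\varphi:X^r\to\mathbb R$ with $\varphi(f)\ge 0$ for all $0\le f\in X^r$ and $\sup_{\|x\|_X\le1}\varphi(|x|^r)^{1/r}<\infty$ such that $$\|Tx\|_F\le\varphi(|x|^r)^{1/r}\qquad\text{for all }x\in X.$$ -/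

import Mathlib

open MeasureTheory Filter Topology

universe u v w

/-! ### The expression `(∑ |x_k|^r)^(1/r)` in a Banach lattice -/

section LatticeCalculus

theorem smul_le_abs_smul_abs_of_lattice {X : Type*} [AddCommGroup X] [Module ℝ X] [Lattice X]
    [IsOrderedModule ℝ X] (c : ℝ) (x : X) : c • x ≤ |c| • |x| := by
  rcases le_total 0 c with h | h
  · rw [abs_of_nonneg h]
    exact smul_le_smul_of_nonneg_left (le_abs_self x) h
  · rw [abs_of_nonpos h, ← neg_smul_neg c x]
    exact smul_le_smul_of_nonneg_left (neg_le_abs x) (neg_nonneg.2 h)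

variable {X : Type*} [NormedAddCommGroup X] [NormedSpace ℝ X] [Lattice X] [IsOrderedAddMonoid X]
  [IsOrderedModule ℝ X] [HasSolidNorm X]

/-- In a Banach lattice, the linear combinations of finitely many vectors with coefficients
from a bounded set have a least upper bound. -/
theorem exists_isLUB_linearCombinations [CompleteSpace X] {n : ℕ} (x : Fin n → X)
    (A : Set (Fin n → ℝ)) (hA : A.Nonempty) (hb : Bornology.IsBounded A) :
    ∃ s : X, IsLUB {y : X | ∃ a ∈ A, y = ∑ k, a k • x k} s := by
  classical
  set L : (Fin n → ℝ) → X := fun a => ∑ k, a k • x k with hL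
  set z : X := ∑ k, |x k| with hz
  have hz0 : 0 ≤ z := Finset.sum_nonneg fun k _ => abs_nonneg (x k)
  have hLip : ∀ (a b : Fin n → ℝ) (ε : ℝ), dist b a ≤ ε → L b ≤ L a + ε • z := by
    intro a b ε hab
    have h1 : L b - L a ≤ ε • z := by
      simp only [hL, hz, Finset.smul_sum, ← Finset.sum_sub_distrib, ← sub_smul]
      refine Finset.sum_le_sum fun k _ => (smul_le_abs_smul_abs_of_lattice _ _).trans ?_
      refine smul_le_smul_of_nonneg_right ?_ (abs_nonneg _)
      exact ((Real.dist_eq _ _).symm.le.trans (dist_le_pi_dist b a k)).trans hab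
    exact sub_le_iff_le_add'.1 h1
  have hstep : ∀ ε : ℝ, 0 < ε → ∃ f : X, (∀ b ∈ A, L b ≤ f + ε • z) ∧
      ∀ y : X, (∀ a ∈ A, L a ≤ y) → f ≤ y := by
    intro ε hε
    obtain ⟨t, htA, htf, hcov⟩ :=
      Metric.finite_approx_of_totallyBounded (hb.isCompact_closure.totallyBounded.subset subset_closure) ε hε
    obtain ⟨a₀, ha₀⟩ := hA
    have htn : htf.toFinset.Nonempty := by
      obtain ⟨c, hc, -⟩ := Set.mem_iUnion₂.1 (hcov ha₀)
      exact ⟨c, htf.mem_toFinset.2 hc⟩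
    refine ⟨htf.toFinset.sup' htn L, fun b hbA => ?_, fun y hy => ?_⟩
    · obtain ⟨c, hc, hbc⟩ := Set.mem_iUnion₂.1 (hcov hbA)
      refine (hLip c b ε (Metric.mem_ball.1 hbc).le).trans ?_
      gcongr
      exact Finset.le_sup' L (htf.mem_toFinset.2 hc)
    · exact Finset.sup'_le htn L fun a ha => hy a (htA (htf.mem_toFinset.1 ha))
  choose! f hf1 hf2 using hstep
  set e : ℕ → ℝ := fun m => 1 / ((m : ℝ) + 1) with he
  have he0 : ∀ m, 0 < e m := fun m => Nat.one_div_pos_of_nat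
  have helim : Tendsto e atTop (𝓝 0) := tendsto_one_div_add_atTop_nhds_zero_nat
  have hanti : ∀ {m N : ℕ}, N ≤ m → e m ≤ e N := fun h => Nat.one_div_le_one_div h
  have hcomp : ∀ m k N : ℕ, N ≤ k → f (e m) - f (e k) ≤ e N • z := by
    intro m k N hk
    have h1 : f (e m) ≤ f (e k) + e k • z := hf2 _ (he0 m) _ (hf1 _ (he0 k))
    exact (sub_le_iff_le_add'.2 h1).trans (smul_le_smul_of_nonneg_right (hanti hk) hz0)
  have hC : CauchySeq fun m => f (e m) := by
    refine cauchySeq_of_le_tendsto_0 (fun N => e N * ‖z‖) (fun m k N hm hk => ?_) ?_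
    · rw [dist_eq_norm]
      have habs : |f (e m) - f (e k)| ≤ |e N • z| := by
        refine (abs_le'.2 ⟨hcomp m k N hk, ?_⟩).trans (le_abs_self _)
        rw [neg_sub]
        exact hcomp k m N hm
      refine (HasSolidNorm.solid habs).trans ?_
      rw [norm_smul, Real.norm_of_nonneg (he0 N).le]
    · simpa using helim.mul_const ‖z‖
  obtain ⟨s, hs⟩ := cauchySeq_tendsto_of_complete hC
  refine ⟨s, ?_, fun y hy => ?_⟩
  · rintro y ⟨b, hbA, rfl⟩
    have hlim : Tendsto (fun m => f (e m) + e m • z) atTop (𝓝 s) := by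
      simpa using hs.add (helim.smul_const z)
    exact ge_of_tendsto' hlim fun m => hf1 _ (he0 m) b hbA
  · exact le_of_tendsto' hs fun m => hf2 _ (he0 m) y fun a ha => hy ⟨a, ha, rfl⟩

/-- The closed unit ball of the dual of `ℓ_r^n` (for `1 ≤ r`): the coefficient vectors `a` with
`∑ a_k t_k ≤ (∑ |t_k|^r)^(1/r)` for all real `t_1, …, t_n`, i.e. the unit ball of `ℓ_{r'}^n`. -/
def dualBall (r : ℝ) (n : ℕ) : Set (Fin n → ℝ) :=
  {a | ∀ t : Fin n → ℝ, ∑ k, a k * t k ≤ (∑ k, |t k| ^ r) ^ (1 / r)}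

theorem dualBall_nonempty (r : ℝ) (n : ℕ) : (dualBall r n).Nonempty :=
  ⟨0, fun t => by
    simpa using Real.rpow_nonneg (Finset.sum_nonneg fun k _ => Real.rpow_nonneg (abs_nonneg _) r) _⟩

theorem dualBall_isBounded (r : ℝ) (n : ℕ) : Bornology.IsBounded (dualBall r n) := by
  classical
  have h : dualBall r n ⊆ Set.univ.pi fun k =>
      Set.Icc (-((∑ j, |(Pi.single k (1 : ℝ) : Fin n → ℝ) j| ^ r) ^ (1 / r)))
        ((∑ j, |(Pi.single k (1 : ℝ) : Fin n → ℝ) j| ^ r) ^ (1 / r)) := by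
    intro a ha k _
    have h1 := ha (Pi.single k 1)
    have h2 := ha (-Pi.single k 1)
    simp only [Pi.neg_apply, abs_neg, mul_neg, Finset.sum_neg_distrib] at h2
    have h3 : ∑ j, a j * (Pi.single k (1 : ℝ) : Fin n → ℝ) j = a k := by
      simp [Pi.single_apply]
    rw [h3] at h1 h2
    exact ⟨by linarith, h1⟩
  exact (Bornology.IsBounded.pi fun k => Metric.isBounded_Icc _ _).subset h

theorem exists_isLUB_dualBall [CompleteSpace X] (r : ℝ) {n : ℕ} (x : Fin n → X) :
    ∃ s : X, IsLUB {y : X | ∃ a ∈ dualBall r n, y = ∑ k, a k • x k} s :=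
  exists_isLUB_linearCombinations x _ (dualBall_nonempty r n) (dualBall_isBounded r n)

/-- The element `(∑ |x_k|^r)^(1/r)` of a Banach lattice (for `1 ≤ r < ∞`): the least upper bound
of the vectors `∑ a_k x_k`, where `a` runs through the unit ball of `ℓ_{r'}^n`, `1/r + 1/r' = 1`.
This least upper bound always exists, and it is the value that the homogeneous functional calculus
of the Banach lattice assigns to the function `t ↦ (∑ |t_k|^r)^(1/r)`. -/
noncomputable def latticePowerSum [CompleteSpace X] (r : ℝ) {n : ℕ} (x : Fin n → X) : X :=
  (exists_isLUB_dualBall r x).choose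

theorem latticePowerSum_isLUB [CompleteSpace X] (r : ℝ) {n : ℕ} (x : Fin n → X) :
    IsLUB {y : X | ∃ a ∈ dualBall r n, y = ∑ k, a k • x k} (latticePowerSum r x) :=
  (exists_isLUB_dualBall r x).choose_spec

end LatticeCalculus

/-- A Banach lattice `F` is `r`-concave. -/
def IsRConcaveLattice (r : ℝ) (F : Type*) [NormedAddCommGroup F] [NormedSpace ℝ F]
    [CompleteSpace F] [Lattice F] [IsOrderedAddMonoid F] [IsOrderedModule ℝ F]
    [HasSolidNorm F] : Prop :=
  ∃ c : ℝ, 0 ≤ c ∧ ∀ (n : ℕ) (x : Fin n → F),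
    (∑ k, ‖x k‖ ^ r) ^ (1 / r) ≤ c * ‖latticePowerSum r x‖

/-- An operator `T` from a Banach lattice `X` into a normed space `F` is `r`-concave. -/
def IsRConcaveOperator (r : ℝ) {X F : Type*} [NormedAddCommGroup X] [NormedSpace ℝ X]
    [CompleteSpace X] [Lattice X] [IsOrderedAddMonoid X] [IsOrderedModule ℝ X]
    [HasSolidNorm X] [NormedAddCommGroup F] [NormedSpace ℝ F] (T : X →L[ℝ] F) : Prop :=
  ∃ c : ℝ, 0 ≤ c ∧ ∀ (n : ℕ) (x : Fin n → X),
    (∑ k, ‖T (x k)‖ ^ r) ^ (1 / r) ≤ c * ‖latticePowerSum r x‖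

/-! ### Banach function spaces -/

section FunctionSpaces

variable {Ω : Type*} [MeasurableSpace Ω] {μ : Measure Ω}

/-- `|x|^p` for a class `x ∈ L₀(μ)`. -/
noncomputable def absPow (p : ℝ) (x : Ω →ₘ[μ] ℝ) : Ω →ₘ[μ] ℝ :=
  x.compMeasurable (fun t : ℝ => |t| ^ p) (by fun_prop)

theorem coeFn_absPow (p : ℝ) (x : Ω →ₘ[μ] ℝ) : absPow p x =ᵐ[μ] fun ω => |x ω| ^ p :=
  AEEqFun.coeFn_compMeasurable _ _ _

/-- A Banach function space over `μ`: a vector space of classes in `L₀(μ)` with a complete norm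
that is an ideal with monotone norm, has full support and has the Fatou property.  The values of
`norm` outside `carrier` carry no meaning. -/
structure BanachFunctionSpace (μ : Measure Ω) where
  carrier : Submodule ℝ (Ω →ₘ[μ] ℝ)
  norm : (Ω →ₘ[μ] ℝ) → ℝ
  norm_add_le : ∀ x ∈ carrier, ∀ y ∈ carrier, norm (x + y) ≤ norm x + norm y
  norm_smul : ∀ (c : ℝ), ∀ x ∈ carrier, norm (c • x) = |c| * norm x
  eq_zero_of_norm : ∀ x ∈ carrier, norm x = 0 → x = 0
  /-- Ideal property. -/
  solid : ∀ x : Ω →ₘ[μ] ℝ, ∀ y ∈ carrier, |x| ≤ |y| → x ∈ carrier ∧ norm x ≤ norm y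
  /-- Full support: a set on which all functions of the space vanish a.e. is a null set. -/
  full_support : ∀ A : Set Ω, MeasurableSet A →
    (∀ x ∈ carrier, ∀ᵐ ω ∂μ, ω ∈ A → x ω = 0) → μ A = 0
  /-- Fatou property. -/
  fatou : ∀ (x : ℕ → Ω →ₘ[μ] ℝ) (y : Ω →ₘ[μ] ℝ), (∀ m, x m ∈ carrier) → y ∈ carrier →
    (∀ m, 0 ≤ x m) →
    (∀ᵐ ω ∂μ, Monotone (fun m => x m ω) ∧ Tendsto (fun m => x m ω) atTop (𝓝 (y ω))) →
    Tendsto (fun m => norm (x m)) atTop (𝓝 (norm y))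
  /-- Completeness. -/
  complete : ∀ x : ℕ → Ω →ₘ[μ] ℝ, (∀ m, x m ∈ carrier) →
    (∀ ε > 0, ∃ N, ∀ m ≥ N, ∀ k ≥ N, norm (x m - x k) < ε) →
    ∃ y ∈ carrier, Tendsto (fun m => norm (x m - y)) atTop (𝓝 0)

namespace BanachFunctionSpace

variable (X : BanachFunctionSpace μ)

/-- `X` is `r`-convex; `(∑ |x_k|^r)^(1/r)` is formed pointwise a.e. and lies in `X`. -/
def IsRConvex (r : ℝ) : Prop :=
  ∃ c : ℝ, 0 ≤ c ∧ ∀ (n : ℕ) (x : Fin n → Ω →ₘ[μ] ℝ), (∀ k, x k ∈ X.carrier) →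
    X.norm (absPow (1 / r) (∑ k, absPow r (x k))) ≤ c * (∑ k, X.norm (x k) ^ r) ^ (1 / r)

/-- The `r`-th power `X^r = {x ∈ L₀(μ) : |x|^(1/r) ∈ X}`, a vector space. -/
def power (r : ℝ) (hr : 0 < r) : Submodule ℝ (Ω →ₘ[μ] ℝ) where
  carrier := {x | absPow (1 / r) x ∈ X.carrier}
  zero_mem' := by
    have h : absPow (1 / r) (0 : Ω →ₘ[μ] ℝ) = 0 := by
      apply AEEqFun.ext
      filter_upwards [coeFn_absPow (1 / r) (0 : Ω →ₘ[μ] ℝ), AEEqFun.coeFn_zero (μ := μ) (β := ℝ)]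
        with ω h1 h2
      rw [h1, h2]
      simp [hr.ne']
    simp only [Set.mem_ofPred_eq, h]
    exact X.carrier.zero_mem
  add_mem' := by
    intro x y hx hy
    have hmem : (2 : ℝ) ^ (1 / r) • (absPow (1 / r) x + absPow (1 / r) y) ∈ X.carrier :=
      X.carrier.smul_mem _ (X.carrier.add_mem hx hy)
    refine (X.solid _ _ hmem ?_).1
    rw [← AEEqFun.coeFn_le]
    filter_upwards [AEEqFun.coeFn_abs (absPow (1 / r) (x + y)),
      AEEqFun.coeFn_abs ((2 : ℝ) ^ (1 / r) • (absPow (1 / r) x + absPow (1 / r) y)),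
      AEEqFun.coeFn_smul ((2 : ℝ) ^ (1 / r)) (absPow (1 / r) x + absPow (1 / r) y),
      AEEqFun.coeFn_add (absPow (1 / r) x) (absPow (1 / r) y),
      coeFn_absPow (1 / r) (x + y), coeFn_absPow (1 / r) x, coeFn_absPow (1 / r) y,
      AEEqFun.coeFn_add x y] with ω h1 h2 h3 h4 h5 h6 h7 h8
    rw [h1, h2, h3, Pi.smul_apply, h4, Pi.add_apply, h5, h6, h7, h8, Pi.add_apply, smul_eq_mul]
    have hp : 0 ≤ 1 / r := by positivity
    have hx0 := Real.rpow_nonneg (abs_nonneg (x ω)) (1 / r)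
    have hy0 := Real.rpow_nonneg (abs_nonneg (y ω)) (1 / r)
    have h20 : (0 : ℝ) ≤ 2 ^ (1 / r) := by positivity
    rw [abs_of_nonneg (Real.rpow_nonneg (abs_nonneg _) _),
      abs_of_nonneg (mul_nonneg h20 (add_nonneg hx0 hy0))]
    have hadd := abs_add_le (x ω) (y ω)
    rcases le_total |x ω| |y ω| with h | h
    · have h9 : |x ω + y ω| ^ (1 / r) ≤ (2 * |y ω|) ^ (1 / r) :=
        Real.rpow_le_rpow (abs_nonneg _) (by linarith) hp
      rw [Real.mul_rpow (by norm_num) (abs_nonneg _)] at h9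
      exact h9.trans (mul_le_mul_of_nonneg_left (by linarith) h20)
    · have h9 : |x ω + y ω| ^ (1 / r) ≤ (2 * |x ω|) ^ (1 / r) :=
        Real.rpow_le_rpow (abs_nonneg _) (by linarith) hp
      rw [Real.mul_rpow (by norm_num) (abs_nonneg _)] at h9
      exact h9.trans (mul_le_mul_of_nonneg_left (by linarith) h20)
  smul_mem' := by
    intro c x hx
    have h : absPow (1 / r) (c • x) = |c| ^ (1 / r) • absPow (1 / r) x := by
      apply AEEqFun.ext
      filter_upwards [coeFn_absPow (1 / r) (c • x), coeFn_absPow (1 / r) x,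
        AEEqFun.coeFn_smul c x, AEEqFun.coeFn_smul (|c| ^ (1 / r)) (absPow (1 / r) x)]
        with ω h1 h2 h3 h4
      rw [h1, h4, Pi.smul_apply, h2, h3, Pi.smul_apply, smul_eq_mul, smul_eq_mul, abs_mul,
        Real.mul_rpow (abs_nonneg _) (abs_nonneg _)]
    simp only [Set.mem_ofPred_eq, h]
    exact X.carrier.smul_mem _ hx

theorem absPow_mem_power (r : ℝ) (hr : 0 < r) {x : Ω →ₘ[μ] ℝ} (hx : x ∈ X.carrier) :
    absPow r x ∈ X.power r hr := by
  refine (X.solid _ x hx (le_of_eq ?_)).1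
  apply AEEqFun.ext
  filter_upwards [AEEqFun.coeFn_abs (absPow (1 / r) (absPow r x)), AEEqFun.coeFn_abs x,
    coeFn_absPow (1 / r) (absPow r x), coeFn_absPow r x] with ω h1 h2 h3 h4
  rw [h1, h2, h3, h4, abs_of_nonneg (Real.rpow_nonneg (abs_nonneg (x ω)) r),
    ← Real.rpow_mul (abs_nonneg _), mul_one_div_cancel hr.ne', Real.rpow_one, abs_abs]

/-- The class `|x|^r`, `x ∈ X`, as an element of `X^r`. -/
noncomputable def toPower (r : ℝ) (hr : 0 < r) (x : X.carrier) : X.power r hr :=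
  ⟨absPow r (x : Ω →ₘ[μ] ℝ), X.absPow_mem_power r hr x.2⟩

/-- A positive operator from `X` into a normed space with an order: a bounded linear map which
takes nonnegative functions to nonnegative elements. -/
def IsPositiveOperator {F : Type*} [NormedAddCommGroup F] [NormedSpace ℝ F] [LE F]
    (T : X.carrier →ₗ[ℝ] F) : Prop :=
  (∃ C : ℝ, ∀ x : X.carrier, ‖T x‖ ≤ C * X.norm x) ∧
    ∀ x : X.carrier, 0 ≤ (x : Ω →ₘ[μ] ℝ) → 0 ≤ T x

/-- `T` is dominated by a positive linear functional `φ` on `X^r` that satisfies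
`sup_{‖x‖ ≤ 1} φ(|x|^r)^(1/r) < ∞`, in the sense that `‖T x‖ ≤ φ(|x|^r)^(1/r)` for all `x ∈ X`. -/
def IsPowerDominated (r : ℝ) (hr : 0 < r) {F : Type*} [NormedAddCommGroup F] [NormedSpace ℝ F]
    (T : X.carrier →ₗ[ℝ] F) : Prop :=
  ∃ φ : X.power r hr →ₗ[ℝ] ℝ,
    (∀ f : X.power r hr, 0 ≤ (f : Ω →ₘ[μ] ℝ) → 0 ≤ φ f) ∧
    BddAbove {s : ℝ | ∃ x : X.carrier, X.norm x ≤ 1 ∧ s = (φ (X.toPower r hr x)) ^ (1 / r)} ∧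
    ∀ x : X.carrier, ‖T x‖ ≤ (φ (X.toPower r hr x)) ^ (1 / r)

end BanachFunctionSpace

end FunctionSpaces

/-! ### Disjointness, Riesz decomposition and partitions of unity in vector lattices -/

section VectorLattice

variable {F : Type*} [AddCommGroup F] [Lattice F] [IsOrderedAddMonoid F]

/-! A positive operator satisfies `(∑|T x_k|^r)^(1/r) ≤ T((∑|x_k|^r)^(1/r))`, because it respects
every linear combination under the supremum. Hence r-concavity of `F` passes to every positive
operator into `F`.

For domination, combine this inequality with r-convexity of `X`: if `∑|x_k|^r ≤ ∑|y_j|^r`, then `∑‖T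
x_k‖^r ≤ M ∑‖y_j‖^r` (`exists_list_sum_le`). This says precisely that the sublinear functional on
`X^r` sending `f` to the infimum of `M ∑‖y_j‖^r - ∑‖T x_k‖^r` over all `f + ∑|x_k|^r ≤ ∑|y_j|^r` is
nonnegative at 0. A linear functional below it, given by Hahn-Banach, is positive and satisfies `‖T
x‖^r ≤ φ(|x|^r) ≤ M ‖x‖^r`.

Conversely, suppose `F` is not r-concave. Vectors `x_k` violating concavity, with `u =
(∑|x_k|^r)^(1/r)`, lie in the order ideal of `u`, which behaves like a space of functions with `u`
as the constant 1. An explicit partition of unity (`exists_hat_decomposition`, refined jointly for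
all `x_k`) yields a positive map from a finite-dimensional `ℓ_∞` to `F` that sends 1 to `u` and
functions `t_k` with `∑|t_k|^r ≤ 2^r` to the `x_k`. Summing such maps with norms at most `2^(-m)`
and ever worse concavity constants gives one positive operator on `ℓ_∞` over a countable set that is
neither r-concave nor dominated, although `ℓ_∞` is r-convex. -/

theorem inf_add_nonpos_of_inf_nonpos {a b c : F} (hc : 0 ≤ c) (hab : a ⊓ b ≤ 0)
    (hac : a ⊓ c ≤ 0) : a ⊓ (b + c) ≤ 0 := by
  have h1 : a ⊓ (b + c) - c ≤ a ⊓ b :=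
    le_inf ((sub_le_self _ hc).trans inf_le_left) (sub_le_iff_le_add.2 inf_le_right)
  have h2 : a ⊓ (b + c) ≤ c := sub_nonpos.1 (h1.trans hab)
  exact (le_inf inf_le_left h2).trans hac

theorem inf_sum_nonpos {ι : Type*} (s : Finset ι) {a : F} {b : ι → F}
    (hb : ∀ i ∈ s, 0 ≤ b i) (h : ∀ i ∈ s, a ⊓ b i ≤ 0) : a ⊓ ∑ i ∈ s, b i ≤ 0 := by
  classical
  induction s using Finset.induction_on with
  | empty => simp
  | insert i s hi ih =>
    rw [Finset.sum_insert hi, add_comm]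
    exact inf_add_nonpos_of_inf_nonpos (hb i (by simp))
      (ih (fun j hj => hb j (by simp [hj])) fun j hj => h j (by simp [hj])) (h i (by simp))

/-- The Riesz decomposition property. -/
theorem exists_sum_eq_of_le_sum {κ : Type*} (s : Finset κ) (v : κ → F) (hv : ∀ j ∈ s, 0 ≤ v j)
    (x : F) (hx : 0 ≤ x) (hxv : x ≤ ∑ j ∈ s, v j) :
    ∃ y : κ → F, (∀ j ∈ s, 0 ≤ y j ∧ y j ≤ v j) ∧ ∑ j ∈ s, y j = x := by
  classical
  induction s using Finset.induction_on generalizing x with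
  | empty => exact ⟨0, by simp, by simpa using le_antisymm hx (by simpa using hxv)⟩
  | insert i s hi ih =>
    rw [Finset.sum_insert hi] at hxv
    have hs : 0 ≤ ∑ j ∈ s, v j := Finset.sum_nonneg fun j hj => hv j (by simp [hj])
    -- The part `x ⊓ v i` goes to index `i`; what remains is `(x - v i) ⊔ 0`, still below the other
    -- summands.
    have hx' : x - x ⊓ v i ≤ ∑ j ∈ s, v j := by
      rw [sub_inf, sub_self]
      exact sup_le hs (sub_le_iff_le_add'.2 hxv)
    obtain ⟨y, hy, hys⟩ := ih (fun j hj => hv j (by simp [hj])) (x - x ⊓ v i)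
      (sub_nonneg.2 inf_le_left) hx'
    have hne : ∀ j ∈ s, j ≠ i := fun j hj h => hi (h ▸ hj)
    refine ⟨Function.update y i (x ⊓ v i), fun j hj => ?_, ?_⟩
    · rcases Finset.mem_insert.1 hj with rfl | hj
      · simpa using ⟨hx, hv _ (by simp)⟩
      · simpa [hne j hj] using hy j hj
    · rw [Finset.sum_insert hi, Finset.sum_congr rfl fun j hj => by
        rw [Function.update_of_ne (hne j hj)], hys]
      simp

/-- Two finite decompositions of the same positive element have a common refinement. -/
theorem exists_common_refinement {ι κ : Type*} [Fintype κ] (s : Finset ι) (a : ι → F) (b : κ → F)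
    (ha : ∀ i ∈ s, 0 ≤ a i) (hb : ∀ j, 0 ≤ b j) (h : ∑ i ∈ s, a i = ∑ j, b j) :
    ∃ w : ι → κ → F, (∀ i ∈ s, ∀ j, 0 ≤ w i j) ∧ (∀ i ∈ s, ∑ j, w i j = a i) ∧
      ∀ j, ∑ i ∈ s, w i j = b j := by
  classical
  induction s using Finset.induction_on generalizing b with
  | empty =>
    refine ⟨0, by simp, by simp, fun j => ?_⟩
    have := (Finset.sum_eq_zero_iff_of_nonneg fun j _ => hb j).1 (h.symm.trans (by simp))
    simpa using (this j (Finset.mem_univ j)).symm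
  | insert i s hi ih =>
    rw [Finset.sum_insert hi] at h
    have has : 0 ≤ ∑ j ∈ s, a j := Finset.sum_nonneg fun j hj => ha j (by simp [hj])
    -- Row `i` of the refinement splits `a i` along the `b j`; the remainders `b j - y j` are left
    -- for the other rows.
    obtain ⟨y, hy, hys⟩ := exists_sum_eq_of_le_sum Finset.univ b (fun j _ => hb j) (a i)
      (ha i (by simp)) (by rw [← h]; exact le_add_of_nonneg_right has)
    obtain ⟨w, hw0, hwa, hwb⟩ := ih (fun j => b j - y j) (fun j hj => ha j (by simp [hj]))
      (fun j => sub_nonneg.2 (hy j (Finset.mem_univ j)).2)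
      (by rw [Finset.sum_sub_distrib, hys, ← h]; abel)
    have hne : ∀ j ∈ s, j ≠ i := fun j hj h => hi (h ▸ hj)
    refine ⟨Function.update w i y, fun k hk j => ?_, fun k hk => ?_, fun j => ?_⟩
    · rcases Finset.mem_insert.1 hk with rfl | hk
      · simpa using (hy j (Finset.mem_univ j)).1
      · simpa [hne k hk] using hw0 k hk j
    · rcases Finset.mem_insert.1 hk with rfl | hk
      · simpa using hys
      · simpa [hne k hk] using hwa k hk
    · rw [Finset.sum_insert hi, Finset.sum_congr rfl fun k hk => by
        rw [Function.update_of_ne (hne k hk)], hwb]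
      simp

theorem sup_zero_inf_eq_sub {y d : F} (hd : 0 ≤ d) :
    (y ⊔ 0) ⊓ d = y ⊔ 0 - (y - d) ⊔ 0 := by
  have h : (y ⊔ 0 - d) ⊔ 0 = (y - d) ⊔ 0 := by
    rw [sup_sub, zero_sub, sup_assoc, sup_eq_right.2 (neg_nonpos.2 hd)]
  rw [← h, sub_sup, sub_sub_cancel, sub_zero, inf_comm]

/-- The difference of two consecutive truncations is supported where `|y|` is at most `d`. -/
theorem truncation_sub_inf_nonpos {y d : F} (hd : 0 ≤ d) :
    (((y + d) ⊔ 0) ⊓ d - (y ⊔ 0) ⊓ d) ⊓ ((|y| - d) ⊔ 0) ≤ 0 := by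
  let _ : DistribLattice F := AddCommGroup.toDistribLattice F
  have h0 : 0 ≤ (y ⊔ 0) ⊓ d := le_inf le_sup_right hd
  have h1 : ((y + d) ⊔ 0) ⊓ d - (y ⊔ 0) ⊓ d ≤ (d + y) ⊔ 0 := by
    rw [add_comm d y]
    exact (sub_le_self _ h0).trans inf_le_left
  have h2 : ((y + d) ⊔ 0) ⊓ d - (y ⊔ 0) ⊓ d ≤ (d - y) ⊔ 0 := by
    refine (sub_le_sub_right inf_le_right _).trans ?_
    rw [sub_inf, sub_self]
    exact sup_le_sup_right (sub_le_sub_left le_sup_left d) 0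
  -- Being below both `(d - y)⁺` and `(d + y)⁺`, the difference is below `(d - |y|)⁺`, which is
  -- disjoint from `(|y| - d)⁺`.
  have h3 : ((y + d) ⊔ 0) ⊓ d - (y ⊔ 0) ⊓ d ≤ (d - |y|) ⊔ 0 := by
    have : (d - |y|) ⊔ 0 = ((d - y) ⊔ 0) ⊓ ((d + y) ⊔ 0) := by
      rw [← sup_inf_right, abs, sub_sup, sub_neg_eq_add]
    rw [this]
    exact le_inf h2 h1
  refine (inf_le_inf_right _ h3).trans ?_
  have := posPart_inf_negPart_eq_zero (d - |y|)
  rw [posPart_def, negPart_def, neg_sub] at this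
  exact this.le

variable [Module ℝ F] [IsOrderedModule ℝ F]

theorem smul_inf_nonpos {a b : F} {c : ℝ} (ha : 0 ≤ a) (hb : 0 ≤ b)
    (h : a ⊓ b ≤ 0) : (c • a) ⊓ b ≤ 0 := by
  -- Dividing by `max c 1` brings the infimum below `a` and `b` at once, whatever the sign of `c`.
  have hM : 0 < max c 1 := lt_max_of_lt_right one_pos
  have h1 : (max c 1)⁻¹ • ((c • a) ⊓ b) ≤ a := by
    refine (smul_le_smul_of_nonneg_left inf_le_left (inv_pos.2 hM).le).trans ?_
    rw [smul_smul]
    refine (smul_le_smul_of_nonneg_right ?_ ha).trans (one_smul ℝ a).le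
    rw [inv_mul_le_iff₀ hM, mul_one]
    exact le_max_left _ _
  have h2 : (max c 1)⁻¹ • ((c • a) ⊓ b) ≤ b := by
    refine (smul_le_smul_of_nonneg_left inf_le_right (inv_pos.2 hM).le).trans ?_
    refine (smul_le_smul_of_nonneg_right ?_ hb).trans (one_smul ℝ b).le
    exact inv_le_one_of_one_le₀ (le_max_right _ _)
  have h3 := smul_le_smul_of_nonneg_left ((le_inf h1 h2).trans h) hM.le
  rwa [smul_smul, mul_inv_cancel₀ hM.ne', one_smul, smul_zero] at h3

/-- If `|x| ≤ u`, then `u` is a sum of positive elements on each of which `x` is, up to `(2/N) u`,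
a multiple of `u`. -/
theorem exists_hat_decomposition {x u : F} (hxu : |x| ≤ u) (N : ℕ) (hN : 0 < N) :
    ∃ (h : Fin (N + 1) → F) (t : Fin (N + 1) → ℝ), (∀ i, 0 ≤ h i) ∧ ∑ i, h i = u ∧
      ∑ i, t i • h i = x ∧ ∀ i, h i ⊓ ((|x - t i • u| - (2 / N : ℝ) • u) ⊔ 0) ≤ 0 := by
  have hu : 0 ≤ u := (abs_nonneg x).trans hxu
  have hN' : (0 : ℝ) < N := by exact_mod_cast hN
  set δ : ℝ := 2 / N with hδ
  have hδ0 : 0 < δ := by positivity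
  have hNδ : N * δ = 2 := by rw [hδ]; field_simp
  set d : F := δ • u with hd
  have hd0 : 0 ≤ d := smul_nonneg hδ0.le hu
  -- The nodes `s 1 = -1, …, s (N + 1) = 1` have spacing `δ`, and `s 0` lies one step to the left.
  -- With `u` read as 1, `δ⁻¹ (c i - c (i + 1))` is the hat function of `x` centred at `s (i + 1)`.
  -- The hats sum to 1, and piecewise linear interpolation reproduces `x` exactly.
  set s : ℕ → ℝ := fun i => -1 + (i - 1) * δ with hs
  have hs1 : ∀ i, s (i + 1) = s i + δ := fun i => by simp only [hs]; push_cast; ring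
  set g : ℕ → F := fun i => (x - s i • u) ⊔ 0 with hg
  set c : ℕ → F := fun i => ((x - s i • u) ⊔ 0) ⊓ d with hc
  have hshift : ∀ i, x - s i • u = x - s (i + 1) • u + d := fun i => by
    rw [hs1, hd]; module
  have hcg : ∀ i, c i = g i - g (i + 1) := fun i => by
    simp only [hc, hg]
    rw [sup_zero_inf_eq_sub hd0]
    congr 2
    rw [hshift i]; abel
  have hcanti : ∀ i, c (i + 1) ≤ c i := fun i => by
    simp only [hc]
    refine inf_le_inf_right _ (sup_le_sup_right ?_ _)
    rw [hshift i]
    exact le_add_of_nonneg_right hd0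
  have hxl : 0 ≤ x + u := by
    have := (neg_le_abs x).trans hxu
    simpa [add_comm] using neg_le_iff_add_nonneg.1 this
  have hc0 : c 0 = d := by
    simp only [hc]
    refine inf_eq_right.2 (le_sup_of_le_left ?_)
    have : x - s 0 • u = (x + u) + d := by
      simp only [hs, hd]; push_cast; module
    rw [this]
    exact le_add_of_nonneg_left hxl
  have hg1 : g 1 = x + u := by
    simp only [hg, hs]
    simpa using hxl
  have hsN : s (N + 1) = 1 := by
    simp only [hs]; push_cast; linarith
  have hgN : g (N + 1) = 0 := by
    simp only [hg]
    rw [hsN, one_smul]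
    exact sup_eq_right.2 (sub_nonpos.2 ((le_abs_self x).trans hxu))
  have hcN : c (N + 1) = 0 := by
    change g (N + 1) ⊓ d = 0
    rw [hgN]
    exact inf_eq_left.2 hd0
  -- Summation by parts, where `∑ c i` telescopes through `g`.
  have hsum : ∀ m, ∑ i ∈ Finset.range m, s (i + 1) • (c i - c (i + 1)) =
      s 1 • c 0 + δ • (g 1 - g (m + 1)) - s (m + 1) • c m := by
    intro m
    induction m with
    | zero => simp
    | succ m ih =>
      rw [Finset.sum_range_succ, ih, hs1 (m + 1), hcg (m + 1)]
      module
  refine ⟨fun i => δ⁻¹ • (c i - c (i + 1)), fun i => s (i + 1), fun i => ?_, ?_, ?_, fun i => ?_⟩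
  · exact smul_nonneg (inv_nonneg.2 hδ0.le) (sub_nonneg.2 (hcanti i))
  · rw [Fin.sum_univ_eq_sum_range (fun i => δ⁻¹ • (c i - c (i + 1))), ← Finset.smul_sum,
      Finset.sum_range_sub', hc0, hcN, sub_zero, hd, smul_smul, inv_mul_cancel₀ hδ0.ne', one_smul]
  · rw [Fin.sum_univ_eq_sum_range (fun i => s (i + 1) • δ⁻¹ • (c i - c (i + 1)))]
    simp_rw [smul_comm _ δ⁻¹]
    have hs1' : s 1 = -1 := by simp [hs]
    rw [← Finset.smul_sum, Finset.sum_range_succ, hcN, sub_zero, hsum, hc0, hg1, hgN, hs1', hd]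
    rw [sub_zero, sub_add_cancel, neg_one_smul, smul_add δ, neg_add_cancel_comm_assoc, smul_smul,
      inv_mul_cancel₀ hδ0.ne', one_smul]
  · refine smul_inf_nonpos (sub_nonneg.2 (hcanti i)) le_sup_right ?_
    simp only [hc]
    rw [hshift i]
    exact truncation_sub_inf_nonpos hd0

/-- Simultaneous version of `exists_hat_decomposition`. -/
theorem exists_joint_decomposition {u : F} (hu : 0 ≤ u) (N : ℕ) (hN : 0 < N) (n : ℕ)
    (x : Fin n → F) (hxu : ∀ k, |x k| ≤ u) :
    ∃ (m : ℕ) (h : Fin m → F) (t : Fin m → Fin n → ℝ), (∀ i, 0 ≤ h i) ∧ ∑ i, h i = u ∧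
      (∀ k, ∑ i, t i k • h i = x k) ∧
      ∀ i k, h i ⊓ ((|x k - t i k • u| - (2 / N : ℝ) • u) ⊔ 0) ≤ 0 := by
  induction n with
  | zero => exact ⟨1, fun _ => u, fun _ => Fin.elim0, fun _ => hu, by simp, fun k => k.elim0,
      fun _ k => k.elim0⟩
  | succ n ih =>
    obtain ⟨m, a, t, ha0, hau, hax, hap⟩ := ih (fun k => x k.succ) fun k => hxu k.succ
    obtain ⟨b, s, hb0, hbu, hbx, hbp⟩ := exists_hat_decomposition (hxu 0) N hN
    -- Each refined piece lies below a piece of both decompositions, so it inherits the disjointness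
    -- relations of both.
    obtain ⟨w, hw0, hwa, hwb⟩ := exists_common_refinement Finset.univ a b (fun i _ => ha0 i) hb0
      (hau.trans hbu.symm)
    have hw0 : ∀ i j, 0 ≤ w i j := fun i j => hw0 i (Finset.mem_univ i) j
    have hwa : ∀ i, ∑ j, w i j = a i := fun i => hwa i (Finset.mem_univ i)
    let e := (Fintype.equivFin (Fin m × Fin (N + 1))).symm
    refine ⟨_, fun i => w (e i).1 (e i).2, fun i => Fin.cons (s (e i).2) (t (e i).1),
      fun i => hw0 _ _, ?_, fun k => ?_, fun i k => ?_⟩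
    · rw [e.sum_comp (fun p => w p.1 p.2), Fintype.sum_prod_type, ← hau]
      exact Finset.sum_congr rfl fun i _ => hwa i
    · rw [e.sum_comp (fun p => (Fin.cons (s p.2) (t p.1) : Fin (n + 1) → ℝ) k • w p.1 p.2)]
      refine Fin.cases ?_ (fun k => ?_) k
      · rw [Fintype.sum_prod_type_right, ← hbx]
        refine Finset.sum_congr rfl fun j _ => ?_
        simp [← Finset.smul_sum, hwb]
      · rw [Fintype.sum_prod_type, ← hax]
        refine Finset.sum_congr rfl fun j _ => ?_
        simp [← Finset.smul_sum, hwa]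
    · refine Fin.cases ?_ (fun k => ?_) k
      · refine (inf_le_inf_right _ ?_).trans (hbp (e i).2)
        rw [← hwb]
        exact Finset.single_le_sum (f := fun j => w j (e i).2) (fun j _ => hw0 j _)
          (Finset.mem_univ _)
      · refine (inf_le_inf_right _ ?_).trans (hap (e i).1 k)
        rw [← hwa]
        exact Finset.single_le_sum (f := fun j => w (e i).1 j) (fun j _ => hw0 _ j)
          (Finset.mem_univ _)

end VectorLattice

/-! ### The unit ball of the dual of `ℓ_r^n` -/

section DualBall

/-- The unit ball `dualBall r n` is norming for `ℓ_r^n`. -/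
theorem exists_mem_dualBall_sum_eq {r : ℝ} (hr : 1 ≤ r) {n : ℕ} (t : Fin n → ℝ) :
    ∃ a ∈ dualBall r n, ∑ k, a k * t k = (∑ k, |t k| ^ r) ^ (1 / r) := by
  classical
  have hr0 : 0 < r := one_pos.trans_le hr
  have : Fact (1 ≤ ENNReal.ofReal r) := ⟨ENNReal.one_le_ofReal.2 hr⟩
  have hnorm : ∀ s : Fin n → ℝ,
      ‖WithLp.toLp (ENNReal.ofReal r) s‖ = (∑ k, |s k| ^ r) ^ (1 / r) := fun s => by
    rw [PiLp.norm_eq_sum (by rwa [ENNReal.toReal_ofReal hr0.le]), ENNReal.toReal_ofReal hr0.le]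
    simp
  -- The coefficients of `a` are the values of a norming functional of `t` on the unit vectors.
  obtain ⟨g, hg1, hgt⟩ := exists_dual_vector'' ℝ (WithLp.toLp (ENNReal.ofReal r) t)
  have hsum : ∀ s : Fin n → ℝ,
      ∑ k, g (WithLp.toLp _ (Pi.single k 1)) * s k = g (WithLp.toLp _ s) := fun s => by
    have : WithLp.toLp (ENNReal.ofReal r) s =
        ∑ k, s k • WithLp.toLp (ENNReal.ofReal r) (Pi.single k (1 : ℝ) : Fin n → ℝ) := by
      ext j
      simp [Pi.single_apply]
    rw [this, map_sum]
    exact Finset.sum_congr rfl fun k _ => by rw [map_smul, smul_eq_mul, mul_comm]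
  refine ⟨fun k => g (WithLp.toLp _ (Pi.single k 1)), fun s => ?_, ?_⟩
  · rw [hsum, ← hnorm]
    exact (le_abs_self _).trans ((g.le_opNorm _).trans
      (mul_le_of_le_one_left (norm_nonneg _) hg1))
  · rw [hsum, hgt, ← hnorm]
    simp

theorem sum_abs_single_rpow {r : ℝ} (hr : 0 < r) {n : ℕ} (k : Fin n) (c : ℝ) :
    (∑ j, |(Pi.single k c : Fin n → ℝ) j| ^ r) ^ (1 / r) = |c| := by
  classical
  rw [Finset.sum_eq_single k (fun j _ hj => by simp [hj, hr.ne']) (by simp), Pi.single_eq_same,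
    ← Real.rpow_mul (abs_nonneg c), mul_one_div_cancel hr.ne', Real.rpow_one]

theorem abs_apply_le_one_of_mem_dualBall {r : ℝ} (hr : 0 < r) {n : ℕ} {a : Fin n → ℝ}
    (ha : a ∈ dualBall r n) (k : Fin n) : |a k| ≤ 1 := by
  classical
  have h : ∀ c : ℝ, a k * c ≤ |c| := fun c => by
    have := ha (Pi.single k c)
    rw [sum_abs_single_rpow hr] at this
    simpa [Pi.single_apply] using this
  have h1 := h 1
  have h2 := h (-1)
  rw [abs_le]
  norm_num at h1 h2
  exact ⟨by linarith, h1⟩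

theorem abs_apply_le_rpow_sum {r : ℝ} (hr : 0 < r) {n : ℕ} (t : Fin n → ℝ) (k : Fin n) :
    |t k| ≤ (∑ j, |t j| ^ r) ^ (1 / r) := by
  have h : |t k| ^ r ≤ ∑ j, |t j| ^ r :=
    Finset.single_le_sum (f := fun j => |t j| ^ r)
      (fun j _ => Real.rpow_nonneg (abs_nonneg _) r) (Finset.mem_univ k)
  have h2 := Real.rpow_le_rpow (Real.rpow_nonneg (abs_nonneg _) r) h (by positivity : 0 ≤ 1 / r)
  rwa [← Real.rpow_mul (abs_nonneg _), mul_one_div_cancel hr.ne', Real.rpow_one] at h2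

theorem single_mem_dualBall {r : ℝ} (hr : 0 < r) {n : ℕ} (k : Fin n) {c : ℝ} (hc : |c| ≤ 1) :
    Pi.single k c ∈ dualBall r n := by
  intro t
  have : ∑ j, (Pi.single k c : Fin n → ℝ) j * t j = c * t k := by simp [Pi.single_apply]
  rw [this]
  refine le_trans ?_ (abs_apply_le_rpow_sum hr t k)
  refine (le_abs_self _).trans ?_
  rw [abs_mul]
  exact mul_le_of_le_one_left (abs_nonneg _) hc

end DualBall

/-! ### Power sums in a Banach lattice and their discretisation -/

section LatticePowerSum

variable {X : Type*} [NormedAddCommGroup X] [NormedSpace ℝ X] [CompleteSpace X] [Lattice X]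
  [IsOrderedAddMonoid X] [IsOrderedModule ℝ X] [HasSolidNorm X]

theorem sum_smul_le_latticePowerSum {r : ℝ} {n : ℕ} (x : Fin n → X) {a : Fin n → ℝ}
    (ha : a ∈ dualBall r n) : ∑ k, a k • x k ≤ latticePowerSum r x :=
  (latticePowerSum_isLUB r x).1 ⟨a, ha, rfl⟩

theorem latticePowerSum_le {r : ℝ} {n : ℕ} (x : Fin n → X) {y : X}
    (h : ∀ a ∈ dualBall r n, ∑ k, a k • x k ≤ y) : latticePowerSum r x ≤ y :=
  (latticePowerSum_isLUB r x).2 (by rintro _ ⟨a, ha, rfl⟩; exact h a ha)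

theorem latticePowerSum_nonneg (r : ℝ) {n : ℕ} (x : Fin n → X) : 0 ≤ latticePowerSum r x := by
  have h0 : (0 : Fin n → ℝ) ∈ dualBall r n := fun t => by
    simpa using Real.rpow_nonneg (Finset.sum_nonneg fun k _ => Real.rpow_nonneg (abs_nonneg _) r) _
  simpa using sum_smul_le_latticePowerSum x h0

theorem abs_le_latticePowerSum {r : ℝ} (hr : 0 < r) {n : ℕ} (x : Fin n → X) (k : Fin n) :
    |x k| ≤ latticePowerSum r x := by
  have h : ∀ c : ℝ, |c| ≤ 1 → c • x k ≤ latticePowerSum r x := fun c hc => by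
    have := sum_smul_le_latticePowerSum x (single_mem_dualBall hr k hc)
    rwa [Finset.sum_eq_single k (fun j _ hj => by simp [hj]) (by simp), Pi.single_eq_same] at this
  refine abs_le'.2 ⟨?_, ?_⟩
  · simpa using h 1 (by simp)
  · simpa using h (-1) (by simp)

/-- Finitely many elements of a Banach lattice are the images of finitely many functions on a
finite set under a positive map which takes the constant one to `(∑ |x_k|^r)^(1/r)`, and the
functions can be chosen with `∑ |t_k|^r ≤ 2^r`. -/
theorem exists_decomposition_latticePowerSum {r : ℝ} (hr : 1 ≤ r) {n : ℕ} (x : Fin n → X) :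
    ∃ (m : ℕ) (w : Fin m → X) (t : Fin n → Fin m → ℝ), (∀ i, 0 ≤ w i) ∧
      ∑ i, w i = latticePowerSum r x ∧ (∀ k, ∑ i, t k i • w i = x k) ∧
      ∀ i, ∑ k, |t k i| ^ r ≤ 2 ^ r := by
  classical
  have hr0 : 0 < r := one_pos.trans_le hr
  set u := latticePowerSum r x with hu
  -- With `2 * (n + 1)` steps the mesh is `1 / (n + 1)`, so the `n` approximation errors add up to
  -- at most `u`.
  obtain ⟨m, w, t, hw0, hwu, hwx, hwp⟩ := exists_joint_decomposition
    (latticePowerSum_nonneg r x) (2 * (n + 1)) (by positivity) n x (abs_le_latticePowerSum hr0 x)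
  have hδ : (2 / ((2 * (n + 1) : ℕ) : ℝ)) = 1 / (n + 1) := by
    push_cast; field_simp
  rw [hδ] at hwp
  set δ : ℝ := 1 / (n + 1) with hδ
  have hnδ : n * δ ≤ 1 := by
    rw [hδ, mul_one_div, div_le_one (by positivity)]; linarith
  -- If `∑ |t k i|^r > 2^r`, a norming `a` gives `∑ a k * t k i > 2`. Off the parts `p k`, which are
  -- disjoint from `w i`, this combination times `u` is at most `∑ a k • x k` plus the errors, hence
  -- at most `2u`. So a positive multiple of `u` is below `∑ p k`; as `w i ≤ u`, disjointness forces
  -- `w i = 0`.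
  have hgood : ∀ i, w i ≠ 0 → ∑ k, |t i k| ^ r ≤ 2 ^ r := by
    intro i hi
    by_contra! hlt
    apply hi
    obtain ⟨a, ha, hat⟩ := exists_mem_dualBall_sum_eq hr (t i)
    have hS : 2 < ∑ k, a k * t i k := by
      rw [hat]
      have := Real.rpow_lt_rpow (by positivity) hlt (by positivity : 0 < 1 / r)
      rwa [← Real.rpow_mul (by norm_num), mul_one_div_cancel hr0.ne', Real.rpow_one] at this
    set p : Fin n → X := fun k => (|x k - t i k • u| - δ • u) ⊔ 0 with hp
    have hpk : ∀ k, a k • (t i k • u) ≤ a k • x k + (δ • u + p k) := fun k => by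
      have h1 : a k • (t i k • u - x k) ≤ |x k - t i k • u| := by
        refine (smul_le_abs_smul_abs_of_lattice _ _).trans ?_
        rw [abs_sub_comm]
        exact (smul_le_smul_of_nonneg_right (abs_apply_le_one_of_mem_dualBall hr0 ha k)
          (abs_nonneg _)).trans (one_smul ℝ _).le
      have h2 : |x k - t i k • u| ≤ δ • u + p k := sub_le_iff_le_add'.1 le_sup_left
      have h3 := h1.trans h2
      rw [smul_sub] at h3
      exact sub_le_iff_le_add'.1 h3
    have hsum : (∑ k, a k * t i k) • u ≤ u + ((n * δ) • u + ∑ k, p k) := by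
      calc (∑ k, a k * t i k) • u = ∑ k, a k • (t i k • u) := by
            rw [Finset.sum_smul]; simp_rw [mul_smul]
        _ ≤ ∑ k, (a k • x k + (δ • u + p k)) := Finset.sum_le_sum fun k _ => hpk k
        _ = ∑ k, a k • x k + ((n * δ) • u + ∑ k, p k) := by
            rw [Finset.sum_add_distrib, Finset.sum_add_distrib, Finset.sum_const]
            simp [mul_smul, Nat.cast_smul_eq_nsmul]
        _ ≤ _ := by
            gcongr
            exact sum_smul_le_latticePowerSum x ha
    have hu0 : 0 ≤ u := latticePowerSum_nonneg r x
    set c : ℝ := ∑ k, a k * t i k - 2 with hc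
    have hc0 : 0 < c := by linarith
    have hcu : c • u ≤ ∑ k, p k := by
      have h1 : (n * δ) • u ≤ u := (smul_le_smul_of_nonneg_right hnδ hu0).trans (one_smul ℝ u).le
      have h2 : (∑ k, a k * t i k) • u ≤ u + (u + ∑ k, p k) := hsum.trans (by gcongr)
      rw [hc, sub_smul, two_smul, sub_le_iff_le_add']
      rwa [← add_assoc] at h2
    have hwi : w i ≤ u := by
      rw [hu, ← hwu]
      exact Finset.single_le_sum (fun j _ => hw0 j) (Finset.mem_univ i)
    have hdisj : w i ⊓ ∑ k, p k ≤ 0 :=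
      inf_sum_nonpos _ (fun k _ => le_sup_right) fun k _ => hwp i k
    have hp0 : 0 ≤ ∑ k, p k := Finset.sum_nonneg fun k _ => le_sup_right
    have h4 : (c • w i) ⊓ ∑ k, p k ≤ 0 := smul_inf_nonpos (hw0 i) hp0 hdisj
    rw [inf_eq_left.2 ((smul_le_smul_of_nonneg_left hwi hc0.le).trans hcu)] at h4
    have h5 := smul_le_smul_of_nonneg_left h4 (inv_nonneg.2 hc0.le)
    rw [smul_smul, inv_mul_cancel₀ hc0.ne', one_smul, smul_zero] at h5
    exact le_antisymm h5 (hw0 i)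
  -- The coefficients on vanishing pieces are uncontrolled but irrelevant, so they are reset to 0.
  refine ⟨m, w, fun k i => if w i = 0 then 0 else t i k, hw0, hwu, fun k => ?_, fun i => ?_⟩
  · rw [← hwx]
    refine Finset.sum_congr rfl fun i _ => ?_
    by_cases h : w i = 0 <;> simp [h]
  · by_cases h : w i = 0
    · simp [h, hr0.ne']; positivity
    · simpa [h] using hgood i h

end LatticePowerSum

/-- The Hahn-Banach theorem for a sublinear functional given by its upper bounds. -/
theorem exists_linearMap_le_of_sublinear {E : Type*} [AddCommGroup E] [Module ℝ E]
    (V : E → ℝ → Prop) (hne : ∀ f, ∃ a, V f a)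
    (hadd : ∀ f g a b, V f a → V g b → V (f + g) (a + b))
    (hsmul : ∀ (c : ℝ) f a, 0 < c → V f a → V (c • f) (c * a)) (h0 : ∀ a, V 0 a → 0 ≤ a) :
    ∃ φ : E →ₗ[ℝ] ℝ, ∀ f a, V f a → φ f ≤ a := by
  set N : E → ℝ := fun f => sInf {a | V f a} with hN
  -- An upper bound `b` at `-f` gives the lower bound `-b` for all upper bounds at `f`, since their
  -- sum is one at 0.
  have hbdd : ∀ f, BddBelow {a | V f a} := fun f => by
    obtain ⟨b, hb⟩ := hne (-f)
    refine ⟨-b, fun a ha => ?_⟩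
    have := h0 _ (by simpa using hadd _ _ _ _ ha hb)
    linarith
  have hle : ∀ f a, V f a → N f ≤ a := fun f a h => csInf_le (hbdd f) h
  have hge : ∀ f b, (∀ a, V f a → b ≤ a) → b ≤ N f := fun f b h => le_csInf (hne f) h
  have hhom : ∀ c : ℝ, 0 < c → ∀ f, N (c • f) ≤ c * N f := fun c hc f => by
    rw [← div_le_iff₀' hc]
    exact hge _ _ fun a ha => (div_le_iff₀' hc).2 (hle _ _ (hsmul c f a hc ha))
  have hhom' : ∀ c : ℝ, 0 < c → ∀ f, N (c • f) = c * N f := fun c hc f => by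
    refine le_antisymm (hhom c hc f) ?_
    have := hhom c⁻¹ (inv_pos.2 hc) (c • f)
    rwa [smul_smul, inv_mul_cancel₀ hc.ne', one_smul, le_inv_mul_iff₀ hc] at this
  have hNadd : ∀ f g, N (f + g) ≤ N f + N g := fun f g => by
    rw [← sub_le_iff_le_add]
    refine hge _ _ fun a ha => ?_
    rw [sub_le_comm]
    refine hge _ _ fun b hb => ?_
    have := hle _ _ (hadd _ _ _ _ ha hb)
    linarith
  have hzero : ∀ x : (⟨⊥, 0⟩ : E →ₗ.[ℝ] ℝ).domain, (⟨⊥, 0⟩ : E →ₗ.[ℝ] ℝ) x ≤ N x := by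
    rintro ⟨f, hf⟩
    rw [Submodule.mem_bot] at hf
    subst hf
    exact hge _ _ fun a ha => h0 a ha
  obtain ⟨φ, -, hφ⟩ := exists_extension_of_le_sublinear _ N hhom' hNadd hzero
  exact ⟨φ, fun f a h => (hφ f).trans (hle f a h)⟩

/-! ### Powers of classes of measurable functions -/

section AbsPow

variable {Ω : Type*} [MeasurableSpace Ω] {μ : Measure Ω}

instance aeEqFun_isOrderedAddMonoid : IsOrderedAddMonoid (Ω →ₘ[μ] ℝ) where
  add_le_add_left x y hxy z := by
    rw [← AEEqFun.coeFn_le] at hxy ⊢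
    filter_upwards [hxy, AEEqFun.coeFn_add x z, AEEqFun.coeFn_add y z] with ω h1 h2 h3
    rw [h2, h3]
    exact add_le_add_left h1 _

theorem absPow_nonneg (p : ℝ) (x : Ω →ₘ[μ] ℝ) : 0 ≤ absPow p x := by
  rw [← AEEqFun.coeFn_le]
  filter_upwards [coeFn_absPow p x, AEEqFun.coeFn_zero (μ := μ) (β := ℝ)] with ω h1 h2
  rw [h1, h2]
  exact Real.rpow_nonneg (abs_nonneg _) _

theorem absPow_smul (p c : ℝ) (x : Ω →ₘ[μ] ℝ) : absPow p (c • x) = |c| ^ p • absPow p x := by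
  apply AEEqFun.ext
  filter_upwards [coeFn_absPow p (c • x), coeFn_absPow p x, AEEqFun.coeFn_smul c x,
    AEEqFun.coeFn_smul (|c| ^ p) (absPow p x)] with ω h1 h2 h3 h4
  rw [h1, h4, Pi.smul_apply, h2, h3, Pi.smul_apply, smul_eq_mul, smul_eq_mul, abs_mul,
    Real.mul_rpow (abs_nonneg _) (abs_nonneg _)]

theorem absPow_mono {p : ℝ} (hp : 0 ≤ p) {x y : Ω →ₘ[μ] ℝ} (hx : 0 ≤ x) (hxy : x ≤ y) :
    absPow p x ≤ absPow p y := by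
  rw [← AEEqFun.coeFn_le] at hx hxy ⊢
  filter_upwards [coeFn_absPow p x, coeFn_absPow p y, hx, hxy,
    AEEqFun.coeFn_zero (μ := μ) (β := ℝ)] with ω h1 h2 h3 h4 h5
  rw [h1, h2]
  rw [h5] at h3
  exact Real.rpow_le_rpow (abs_nonneg _) (abs_le_abs_of_nonneg h3 h4) hp

theorem le_absPow_absPow {r : ℝ} (hr : 0 < r) (x : Ω →ₘ[μ] ℝ) :
    x ≤ absPow r (absPow (1 / r) x) := by
  rw [← AEEqFun.coeFn_le]
  filter_upwards [coeFn_absPow r (absPow (1 / r) x), coeFn_absPow (1 / r) x] with ω h1 h2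
  rw [h1, h2, abs_of_nonneg (Real.rpow_nonneg (abs_nonneg _) _), ← Real.rpow_mul (abs_nonneg _),
    one_div_mul_cancel hr.ne', Real.rpow_one]
  exact le_abs_self _

/-- Pointwise Hölder inequality. -/
theorem sum_smul_le_absPow_sum {r : ℝ} {n : ℕ} (x : Fin n → Ω →ₘ[μ] ℝ) {a : Fin n → ℝ}
    (ha : a ∈ dualBall r n) : ∑ k, a k • x k ≤ absPow (1 / r) (∑ k, absPow r (x k)) := by
  rw [← AEEqFun.coeFn_le]
  have h1 : ∀ᵐ ω ∂μ, ∀ k, (a k • x k : Ω →ₘ[μ] ℝ) ω = a k * x k ω :=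
    ae_all_iff.2 fun k => AEEqFun.coeFn_smul (a k) (x k)
  have h2 : ∀ᵐ ω ∂μ, ∀ k, absPow r (x k) ω = |x k ω| ^ r :=
    ae_all_iff.2 fun k => coeFn_absPow r (x k)
  filter_upwards [h1, h2, AEEqFun.coeFn_finsetSum Finset.univ (fun k => a k • x k),
    AEEqFun.coeFn_finsetSum Finset.univ (fun k => absPow r (x k)),
    coeFn_absPow (1 / r) (∑ k, absPow r (x k))] with ω h1 h2 h3 h4 h5
  rw [h3, h5, h4]
  simp only [Finset.sum_apply, h1, h2]
  rw [abs_of_nonneg (Finset.sum_nonneg fun k _ => Real.rpow_nonneg (abs_nonneg _) r)]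
  exact ha fun k => x k ω

end AbsPow

/-! ### From r-concavity of `F` to domination by a functional -/

namespace BanachFunctionSpace

variable {Ω : Type*} [MeasurableSpace Ω] {μ : Measure Ω} (X : BanachFunctionSpace μ)

theorem norm_nonneg {x : Ω →ₘ[μ] ℝ} (hx : x ∈ X.carrier) : 0 ≤ X.norm x := by
  have h0 : X.norm 0 = 0 := by simpa using X.norm_smul 0 x hx
  have h1 := X.norm_add_le x hx ((-1 : ℝ) • x) (X.carrier.smul_mem _ hx)
  rw [X.norm_smul _ x hx] at h1
  have h2 : x + (-1 : ℝ) • x = 0 := by rw [neg_one_smul, add_neg_cancel]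
  rw [h2, h0] at h1
  norm_num at h1
  linarith

theorem norm_mono {x y : Ω →ₘ[μ] ℝ} (hy : y ∈ X.carrier) (hx : 0 ≤ x) (hxy : x ≤ y) :
    X.norm x ≤ X.norm y :=
  (X.solid x y hy (by rwa [abs_of_nonneg hx, abs_of_nonneg (hx.trans hxy)])).2

theorem powerSum_mem {r : ℝ} (hr : 0 < r) {n : ℕ} (x : Fin n → X.carrier) :
    absPow (1 / r) (∑ k, absPow r (x k : Ω →ₘ[μ] ℝ)) ∈ X.carrier :=
  (X.power r hr).sum_mem fun k _ => X.absPow_mem_power r hr (x k).2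

section Operator

variable {F : Type*} [NormedAddCommGroup F] [NormedSpace ℝ F] [CompleteSpace F]
    [Lattice F] [IsOrderedAddMonoid F] [IsOrderedModule ℝ F] [HasSolidNorm F]

theorem IsPositiveOperator.exists_concave {X : BanachFunctionSpace μ} {r : ℝ} (hr : 0 < r)
    (hF : IsRConcaveLattice r F) {T : X.carrier →ₗ[ℝ] F} (hT : X.IsPositiveOperator T) :
    ∃ C : ℝ, 0 ≤ C ∧ ∀ (n : ℕ) (x : Fin n → X.carrier), ∑ k, ‖T (x k)‖ ^ r ≤
      C * X.norm (absPow (1 / r) (∑ k, absPow r (x k : Ω →ₘ[μ] ℝ))) ^ r := by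
  obtain ⟨⟨C, hC⟩, hpos⟩ := hT
  obtain ⟨K, hK0, hK⟩ := hF
  refine ⟨(K * max C 0) ^ r, by positivity, fun n x => ?_⟩
  set y : X.carrier := ⟨_, X.powerSum_mem hr x⟩ with hy
  have hle : latticePowerSum r (fun k => T (x k)) ≤ T y := by
    refine latticePowerSum_le _ fun a ha => ?_
    simp_rw [← map_smul, ← map_sum]
    rw [← sub_nonneg, ← map_sub]
    refine hpos _ ?_
    have : ((y - ∑ k, a k • x k : X.carrier) : Ω →ₘ[μ] ℝ) =
        absPow (1 / r) (∑ k, absPow r (x k : Ω →ₘ[μ] ℝ)) -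
          ∑ k, a k • (x k : Ω →ₘ[μ] ℝ) := by
      simp [hy]
    rw [this, sub_nonneg]
    exact sum_smul_le_absPow_sum _ ha
  have h0 := latticePowerSum_nonneg r (fun k => T (x k))
  have hnorm : ‖latticePowerSum r (fun k => T (x k))‖ ≤ max C 0 * X.norm y := by
    refine (norm_le_norm_of_abs_le_abs
      (by rwa [abs_of_nonneg h0, abs_of_nonneg (h0.trans hle)])).trans ((hC y).trans ?_)
    exact mul_le_mul_of_nonneg_right (le_max_left _ _) (X.norm_nonneg y.2)
  have h1 := (hK n fun k => T (x k)).trans (mul_le_mul_of_nonneg_left hnorm hK0)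
  have hS : 0 ≤ ∑ k, ‖T (x k)‖ ^ r :=
    Finset.sum_nonneg fun k _ => Real.rpow_nonneg (_root_.norm_nonneg _) r
  have h2 := Real.rpow_le_rpow (Real.rpow_nonneg hS _) h1 hr.le
  rw [← Real.rpow_mul hS, one_div_mul_cancel hr.ne', Real.rpow_one, ← mul_assoc,
    Real.mul_rpow (by positivity) (X.norm_nonneg y.2)] at h2
  exact h2

/-- Concavity of `T` bounds the left sum by the norm of the power sum of `A`, monotonicity passes to
`B`, and convexity of `X` bounds that by the right sum. Lists are used because concatenation adds
the sums. -/
theorem IsPositiveOperator.exists_list_sum_le {X : BanachFunctionSpace μ} {r : ℝ} (hr : 0 < r)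
    (hF : IsRConcaveLattice r F) (hX : X.IsRConvex r) {T : X.carrier →ₗ[ℝ] F}
    (hT : X.IsPositiveOperator T) :
    ∃ M : ℝ, 0 ≤ M ∧ ∀ A B : List X.carrier,
      (A.map fun x : X.carrier => absPow r (x : Ω →ₘ[μ] ℝ)).sum ≤
        (B.map fun x : X.carrier => absPow r (x : Ω →ₘ[μ] ℝ)).sum →
      (A.map fun x : X.carrier => ‖T x‖ ^ r).sum ≤ M * (B.map fun x : X.carrier => X.norm x ^ r).sum := by
  obtain ⟨C, hC0, hC⟩ := hT.exists_concave hr hF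
  obtain ⟨c, hc0, hc⟩ := hX
  refine ⟨C * c ^ r, by positivity, fun A B hAB => ?_⟩
  have h1 := hC _ (fun k : Fin A.length => A[k])
  have h2 := hc _ (fun k : Fin B.length => (B[k] : Ω →ₘ[μ] ℝ)) fun k => (B[k]).2
  have hA := X.powerSum_mem hr (fun k : Fin A.length => A[k])
  have hB := X.powerSum_mem hr (fun k : Fin B.length => B[k])
  simp only [Fin.getElem_fin] at h1 h2 hA hB
  rw [Fin.sum_univ_fun_getElem A (fun x : X.carrier => ‖T x‖ ^ r),
    Fin.sum_univ_fun_getElem A (fun x : X.carrier => absPow r (x : Ω →ₘ[μ] ℝ))] at h1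
  rw [Fin.sum_univ_fun_getElem B (fun x : X.carrier => X.norm x ^ r),
    Fin.sum_univ_fun_getElem B (fun x : X.carrier => absPow r (x : Ω →ₘ[μ] ℝ))] at h2
  rw [Fin.sum_univ_fun_getElem A (fun x : X.carrier => absPow r (x : Ω →ₘ[μ] ℝ))] at hA
  rw [Fin.sum_univ_fun_getElem B (fun x : X.carrier => absPow r (x : Ω →ₘ[μ] ℝ))] at hB
  have hA0 : 0 ≤ (A.map fun x : X.carrier => absPow r (x : Ω →ₘ[μ] ℝ)).sum :=
    List.sum_nonneg fun y hy => by
      obtain ⟨x, -, rfl⟩ := List.mem_map.1 hy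
      exact absPow_nonneg r _
  have hS : 0 ≤ (B.map fun x : X.carrier => X.norm x ^ r).sum :=
    List.sum_nonneg fun y hy => by
      obtain ⟨x, -, rfl⟩ := List.mem_map.1 hy
      exact Real.rpow_nonneg (X.norm_nonneg x.2) r
  have h3 := (X.norm_mono hB (absPow_nonneg _ _)
    (absPow_mono (by positivity : 0 ≤ 1 / r) hA0 hAB)).trans h2
  have h4 := Real.rpow_le_rpow (X.norm_nonneg hA) h3 hr.le
  rw [Real.mul_rpow hc0 (Real.rpow_nonneg hS _), ← Real.rpow_mul hS, one_div_mul_cancel hr.ne',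
    Real.rpow_one] at h4
  rw [mul_assoc]
  exact h1.trans (mul_le_mul_of_nonneg_left h4 hC0)

theorem IsPositiveOperator.isPowerDominated {X : BanachFunctionSpace μ} {r : ℝ} (hr : 0 < r)
    (hF : IsRConcaveLattice r F) (hX : X.IsRConvex r) {T : X.carrier →ₗ[ℝ] F}
    (hT : X.IsPositiveOperator T) : X.IsPowerDominated r hr T := by
  obtain ⟨M, hM0, hM⟩ := hT.exists_list_sum_le hr hF hX
  set P : List X.carrier → (Ω →ₘ[μ] ℝ) :=
    fun A => (A.map fun x : X.carrier => absPow r (x : Ω →ₘ[μ] ℝ)).sum with hP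
  set S : List X.carrier → ℝ := fun A => (A.map fun x : X.carrier => ‖T x‖ ^ r).sum with hS
  set R : List X.carrier → ℝ := fun A => (A.map fun x : X.carrier => X.norm x ^ r).sum with hR
  -- Scaling the members by `c ^ (1 / r)` multiplies all r-th powers by `c`; this makes `V`
  -- positively homogeneous.
  have hscale : ∀ (c : ℝ) (A : List X.carrier), 0 < c →
      P (A.map fun x => c ^ (1 / r) • x) = c • P A ∧
      S (A.map fun x => c ^ (1 / r) • x) = c * S A ∧
      R (A.map fun x => c ^ (1 / r) • x) = c * R A := by
    intro c A hc
    have hcp : (0 : ℝ) ≤ c ^ (1 / r) := Real.rpow_nonneg hc.le _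
    have hcr : (c ^ (1 / r)) ^ r = c := by
      rw [← Real.rpow_mul hc.le, one_div_mul_cancel hr.ne', Real.rpow_one]
    induction A with
    | nil => simp [hP, hS, hR]
    | cons x A ih =>
      obtain ⟨h1, h2, h3⟩ := ih
      simp only [hP, hS, hR, List.map_cons, List.sum_cons] at h1 h2 h3 ⊢
      refine ⟨?_, ?_, ?_⟩
      · rw [h1, smul_add, Submodule.coe_smul, absPow_smul, abs_of_nonneg hcp, hcr]
      · rw [h2, mul_add, map_smul, _root_.norm_smul, Real.norm_of_nonneg hcp,
          Real.mul_rpow hcp (_root_.norm_nonneg _), hcr]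
      · rw [h3, mul_add, Submodule.coe_smul, X.norm_smul _ _ x.2, abs_of_nonneg hcp,
          Real.mul_rpow hcp (X.norm_nonneg x.2), hcr]
  -- `V f a` collects the values whose infimum is the sublinear functional. Pairs `(A, B)` with `A`
  -- empty will bound `φ` above, those with `B` empty will bound it below.
  let V : X.power r hr → ℝ → Prop := fun f a => ∃ A B : List X.carrier,
    (f : Ω →ₘ[μ] ℝ) + P A ≤ P B ∧ a = M * R B - S A
  have hne : ∀ f, ∃ a, V f a := by
    intro f
    refine ⟨_, [], [⟨_, f.2⟩], ?_, rfl⟩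
    simpa [hP] using le_absPow_absPow hr (f : Ω →ₘ[μ] ℝ)
  have hadd : ∀ f g a b, V f a → V g b → V (f + g) (a + b) := by
    rintro f g _ _ ⟨A, B, h, rfl⟩ ⟨A', B', h', rfl⟩
    refine ⟨A ++ A', B ++ B', ?_, ?_⟩
    · have := add_le_add h h'
      simp only [hP, List.map_append, List.sum_append, Submodule.coe_add] at this ⊢
      rwa [add_add_add_comm]
    · simp only [hR, hS, List.map_append, List.sum_append]
      ring
  have hsmul : ∀ (c : ℝ) f a, 0 < c → V f a → V (c • f) (c * a) := by
    rintro c f _ hc ⟨A, B, h, rfl⟩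
    refine ⟨A.map fun x => c ^ (1 / r) • x, B.map fun x => c ^ (1 / r) • x, ?_, ?_⟩
    · rw [(hscale c A hc).1, (hscale c B hc).1, Submodule.coe_smul, ← smul_add]
      rw [← AEEqFun.coeFn_le] at h ⊢
      filter_upwards [h, AEEqFun.coeFn_smul c ((f : Ω →ₘ[μ] ℝ) + P A),
        AEEqFun.coeFn_smul c (P B)] with ω h1 h2 h3
      rw [h2, h3]
      exact mul_le_mul_of_nonneg_left h1 hc.le
    · rw [(hscale c A hc).2.1, (hscale c B hc).2.2]
      ring
  have hzero : ∀ a, V 0 a → 0 ≤ a := by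
    rintro _ ⟨A, B, h, rfl⟩
    have := hM A B (by rwa [Submodule.coe_zero, zero_add] at h)
    exact sub_nonneg.2 this
  obtain ⟨φ, hφ⟩ := exists_linearMap_le_of_sublinear V hne hadd hsmul hzero
  have hup : ∀ x : X.carrier, φ (X.toPower r hr x) ≤ M * X.norm x ^ r := fun x =>
    hφ _ _ ⟨[], [x], by simp [hP, toPower], by simp [hR, hS]⟩
  have hlow : ∀ x : X.carrier, ‖T x‖ ^ r ≤ φ (X.toPower r hr x) := fun x => by
    have := hφ (-X.toPower r hr x) _ ⟨[x], [], by simp [hP, toPower], rfl⟩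
    simp only [map_neg, hR, hS] at this
    simp at this
    linarith
  refine ⟨φ, fun f hf => ?_, ⟨M ^ (1 / r), ?_⟩, fun x => ?_⟩
  -- Positivity: empty lists give the bound 0 at `-f`.
  · have := hφ (-f) 0 ⟨[], [], by simpa [hP] using hf, by simp [hR, hS]⟩
    simpa using this
  · rintro s ⟨x, hx, rfl⟩
    have h0 : 0 ≤ φ (X.toPower r hr x) :=
      (Real.rpow_nonneg (_root_.norm_nonneg _) r).trans (hlow x)
    refine Real.rpow_le_rpow h0 ((hup x).trans ?_) (by positivity)
    exact mul_le_of_le_one_right hM0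
      (Real.rpow_le_one (X.norm_nonneg x.2) hx hr.le)
  · have := Real.rpow_le_rpow (Real.rpow_nonneg (_root_.norm_nonneg _) r) (hlow x)
      (by positivity : 0 ≤ 1 / r)
    rwa [← Real.rpow_mul (_root_.norm_nonneg _), mul_one_div_cancel hr.ne',
      Real.rpow_one] at this

end Operator

end BanachFunctionSpace

/-! ### `L_∞` as an r-convex Banach function space -/

section LInfty

variable {Ω : Type*} [MeasurableSpace Ω] {μ : Measure Ω}

theorem ae_abs_le_norm_Lp_top (f : Lp ℝ ⊤ μ) : ∀ᵐ ω ∂μ, |f ω| ≤ ‖f‖ := by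
  filter_upwards [ae_le_eLpNormEssSup (f := f) (μ := μ)] with ω hω
  rw [Lp.norm_def, eLpNorm_exponent_top]
  have h := ENNReal.toReal_mono (by simpa using Lp.eLpNorm_ne_top f) hω
  simpa using h

theorem Lp_top_norm_le {f : Lp ℝ ⊤ μ} {C : ℝ} (hC : 0 ≤ C) (h : ∀ᵐ ω ∂μ, |f ω| ≤ C) :
    ‖f‖ ≤ C := by
  rw [Lp.norm_def, eLpNorm_exponent_top]
  exact ENNReal.toReal_le_of_le_ofReal hC (eLpNormEssSup_le_of_ae_bound h)

variable (μ) in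
/-- The space `L_∞(μ)` as a Banach function space. -/
noncomputable def linftySpace : BanachFunctionSpace μ where
  carrier := Lp.LpSubmodule ℝ ℝ ⊤ μ
  norm x := (eLpNorm x ⊤ μ).toReal
  norm_add_le x hx y hy := norm_add_le (⟨x, hx⟩ : Lp ℝ ⊤ μ) ⟨y, hy⟩
  norm_smul c x hx := norm_smul c (⟨x, hx⟩ : Lp ℝ ⊤ μ)
  eq_zero_of_norm x hx h := congrArg Subtype.val (norm_eq_zero.1 h : (⟨x, hx⟩ : Lp ℝ ⊤ μ) = 0)
  solid x y hy h := by
    have hle : eLpNorm x ⊤ μ ≤ eLpNorm y ⊤ μ := by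
      refine eLpNorm_mono_ae ?_
      rw [← AEEqFun.coeFn_le] at h
      filter_upwards [h, AEEqFun.coeFn_abs x, AEEqFun.coeFn_abs y] with ω h1 h2 h3
      rwa [h2, h3] at h1
    have hy' : eLpNorm y ⊤ μ < ⊤ := hy
    exact ⟨lt_of_le_of_lt hle hy', ENNReal.toReal_mono hy'.ne hle⟩
  full_support A _ h := by
    have h1 : AEEqFun.const Ω (1 : ℝ) ∈ Lp.LpSubmodule ℝ ℝ ⊤ μ :=
      Lp.mem_Lp_iff_memLp.2 ((memLp_congr_ae (AEEqFun.coeFn_const Ω (1 : ℝ))).2 (memLp_top_const 1))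
    have h2 : ∀ᵐ ω ∂μ, ω ∉ A := by
      filter_upwards [h _ h1, AEEqFun.coeFn_const (μ := μ) Ω (1 : ℝ)] with ω h3 h4 h5
      rw [h4] at h3
      exact one_ne_zero (h3 h5)
    exact measure_eq_zero_iff_ae_notMem.2 h2
  fatou x y hx hy hx0 h := by
    have hy' : eLpNorm y ⊤ μ < ⊤ := hy
    have hle : ∀ m, eLpNorm (x m) ⊤ μ ≤ eLpNorm y ⊤ μ := fun m => by
      refine eLpNorm_mono_ae ?_
      have := hx0 m
      rw [← AEEqFun.coeFn_le] at this
      filter_upwards [h, this, AEEqFun.coeFn_zero (μ := μ) (β := ℝ)] with ω h1 h2 h3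
      rw [h3] at h2
      exact abs_le_abs_of_nonneg h2 (h1.1.ge_of_tendsto h1.2 m)
    refine (ENNReal.tendsto_toReal hy'.ne).comp ?_
    -- Monotonicity bounds the limsup; lower semicontinuity of the essential supremum bounds the
    -- liminf.
    refine tendsto_of_le_liminf_of_limsup_le ?_ (limsup_le_of_le (h := .of_forall hle))
    exact Lp.eLpNorm_exponent_top_lim_le_liminf_eLpNorm_exponent_top (h.mono fun ω h => h.2)
  complete x hx h := by
    have hC : CauchySeq fun m => (⟨x m, hx m⟩ : Lp ℝ ⊤ μ) := by
      rw [Metric.cauchySeq_iff]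
      intro ε hε
      obtain ⟨N, hN⟩ := h ε hε
      refine ⟨N, fun m hm k hk => ?_⟩
      rw [dist_eq_norm]
      exact hN m hm k hk
    obtain ⟨y, hy⟩ := cauchySeq_tendsto_of_complete hC
    exact ⟨y, y.2, tendsto_iff_norm_sub_tendsto_zero.1 hy⟩

theorem linftySpace_isRConvex {r : ℝ} (hr : 0 < r) : (linftySpace μ).IsRConvex r := by
  refine ⟨1, zero_le_one, fun n x hx => ?_⟩
  have hS : 0 ≤ ∑ k, (linftySpace μ).norm (x k) ^ r :=
    Finset.sum_nonneg fun k _ => Real.rpow_nonneg ENNReal.toReal_nonneg r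
  have hmem := (linftySpace μ).powerSum_mem hr fun k => ⟨x k, hx k⟩
  rw [one_mul]
  refine Lp_top_norm_le (f := ⟨_, hmem⟩) (Real.rpow_nonneg hS _) ?_
  have h1 : ∀ᵐ ω ∂μ, ∀ k, |x k ω| ≤ (linftySpace μ).norm (x k) :=
    ae_all_iff.2 fun k => ae_abs_le_norm_Lp_top ⟨x k, hx k⟩
  have h2 : ∀ᵐ ω ∂μ, ∀ k, absPow r (x k) ω = |x k ω| ^ r :=
    ae_all_iff.2 fun k => coeFn_absPow r (x k)
  filter_upwards [h1, h2, AEEqFun.coeFn_finsetSum Finset.univ (fun k => absPow r (x k)),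
    coeFn_absPow (1 / r) (∑ k, absPow r (x k))] with ω h1 h2 h3 h4
  change |absPow (1 / r) (∑ k, absPow r (x k)) ω| ≤ _
  have h0 : 0 ≤ ∑ k, |x k ω| ^ r :=
    Finset.sum_nonneg fun k _ => Real.rpow_nonneg (abs_nonneg _) r
  rw [h4, h3]
  simp only [Finset.sum_apply, h2]
  rw [abs_of_nonneg h0, abs_of_nonneg (Real.rpow_nonneg h0 _)]
  refine Real.rpow_le_rpow h0 (Finset.sum_le_sum fun k _ => ?_) (by positivity)
  exact Real.rpow_le_rpow (abs_nonneg _) (h1 k) hr.le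

instance lp_isOrderedModule {p : ENNReal} : IsOrderedModule ℝ (Lp ℝ p μ) where
  smul_le_smul_of_nonneg_left c hc f g hfg := by
    rw [← Lp.coeFn_le] at hfg ⊢
    filter_upwards [hfg, Lp.coeFn_smul c f, Lp.coeFn_smul c g] with ω h1 h2 h3
    rw [h2, h3]
    exact mul_le_mul_of_nonneg_left h1 hc
  smul_le_smul_of_nonneg_right f hf c d hcd := by
    rw [← Lp.coeFn_nonneg] at hf
    rw [← Lp.coeFn_le]
    filter_upwards [hf, Lp.coeFn_smul c f, Lp.coeFn_smul d f] with ω h1 h2 h3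
    rw [h2, h3]
    exact mul_le_mul_of_nonneg_right hcd h1

end LInfty

/-! ### A bad positive operator on `ℓ_∞` when `F` is not r-concave -/

section BlockOperator

variable {F : Type*} [NormedAddCommGroup F] [NormedSpace ℝ F] [Lattice F]
  [IsOrderedAddMonoid F] [IsOrderedModule ℝ F] [HasSolidNorm F]

theorem norm_sum_smul_le {ι : Type*} [Fintype ι] {w : ι → F} (hw : ∀ i, 0 ≤ w i) {a : ι → ℝ}
    {C : ℝ} (ha : ∀ i, |a i| ≤ C) (hC : 0 ≤ C) : ‖∑ i, a i • w i‖ ≤ C * ‖∑ i, w i‖ := by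
  have h : |∑ i, a i • w i| ≤ |C • ∑ i, w i| := by
    have hle : ∀ b : ι → ℝ, (∀ i, |b i| ≤ C) → ∑ i, b i • w i ≤ C • ∑ i, w i := fun b hb => by
      rw [Finset.smul_sum]
      exact Finset.sum_le_sum fun i _ =>
        smul_le_smul_of_nonneg_right ((le_abs_self _).trans (hb i)) (hw i)
    refine (abs_le'.2 ⟨hle a ha, ?_⟩).trans (le_abs_self _)
    rw [← Finset.sum_neg_distrib]
    simp_rw [← neg_smul]
    exact hle (fun i => -a i) (by simpa using ha)
  refine (norm_le_norm_of_abs_le_abs h).trans_eq ?_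
  rw [norm_smul, Real.norm_of_nonneg hC]

variable [CompleteSpace F]

/-- A sequence of finite families of positive vectors whose sums are absolutely summable defines a
positive operator on `ℓ_∞`. -/
theorem exists_block_operator {N : ℕ → ℕ} (w : ∀ m, Fin (N m) → F) (hw0 : ∀ m i, 0 ≤ w m i)
    (hw : Summable fun m => ‖∑ i, w m i‖) {Ω : Type*} [MeasurableSpace Ω]
    [MeasurableSingletonClass Ω] (e : Ω ≃ Σ m, Fin (N m)) :
    ∃ T : Lp ℝ ⊤ (Measure.count : Measure Ω) →L[ℝ] F, (∀ f, 0 ≤ f → 0 ≤ T f) ∧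
      ∀ f m, (∀ ω, (e ω).1 ≠ m → f ω = 0) → T f = ∑ i, f (e.symm ⟨m, i⟩) • w m i := by
  set g : Lp ℝ ⊤ (Measure.count : Measure Ω) → ℕ → F :=
    fun f m => ∑ i, f (e.symm ⟨m, i⟩) • w m i with hg
  have hbound : ∀ f m, ‖g f m‖ ≤ ‖f‖ * ‖∑ i, w m i‖ := fun f m =>
    norm_sum_smul_le (hw0 m) (fun i => Measure.ae_count_iff.1 (ae_abs_le_norm_Lp_top f) _)
      (norm_nonneg f)
  have hsum : ∀ f, Summable (g f) := fun f =>
    .of_norm_bounded (hw.mul_left ‖f‖) (hbound f)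
  let T₀ : Lp ℝ ⊤ (Measure.count : Measure Ω) →ₗ[ℝ] F :=
    { toFun := fun f => ∑' m, g f m
      map_add' := fun f f' => by
        rw [← (hsum f).tsum_add (hsum f')]
        congr 1 with m
        simp only [hg, ← Finset.sum_add_distrib, ← add_smul,
          Measure.ae_count_iff.1 (Lp.coeFn_add f f') _, Pi.add_apply]
      map_smul' := fun c f => by
        rw [RingHom.id_apply, ← (hsum f).tsum_const_smul]
        congr 1 with m
        simp only [hg, Finset.smul_sum, smul_smul,
          Measure.ae_count_iff.1 (Lp.coeFn_smul c f) _, Pi.smul_apply, smul_eq_mul] }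
  refine ⟨T₀.mkContinuous (∑' m, ‖∑ i, w m i‖) fun f => ?_, fun f hf => ?_, fun f m hf => ?_⟩
  · rw [mul_comm, ← tsum_mul_left]
    exact tsum_of_norm_bounded (hw.mul_left ‖f‖).hasSum (hbound f)
  · have hf' := Measure.ae_count_iff.1 ((Lp.coeFn_nonneg f).2 hf)
    exact tsum_nonneg fun m => Finset.sum_nonneg fun i _ => smul_nonneg (hf' _) (hw0 m i)
  · change ∑' m, g f m = g f m
    refine tsum_eq_single m fun m' hm' => Finset.sum_eq_zero fun i _ => ?_
    rw [hf _ (by simpa using hm'), zero_smul]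

/-- In a lattice that is not `r`-concave there are positive maps on finite-dimensional `ℓ_∞` of
arbitrarily small norm and arbitrarily large `r`-concavity constant. -/
theorem exists_block_of_not_isRConcaveLattice {r : ℝ} (hr : 1 ≤ r) (hF : ¬ IsRConcaveLattice r F)
    (m : ℕ) : ∃ (N : ℕ) (w : Fin N → F), (∀ i, 0 ≤ w i) ∧ ‖∑ i, w i‖ ≤ (1 / 2) ^ m ∧
      ∃ (n : ℕ) (t : Fin n → Fin N → ℝ), (∀ i, ∑ k, |t k i| ^ r ≤ 1) ∧
        m < (∑ k, ‖∑ i, t k i • w i‖ ^ r) ^ (1 / r) := by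
  have hr0 : 0 < r := one_pos.trans_le hr
  -- In the constant, `2 ^ m` pays for shrinking the block to norm `2^(-m)`, the factor 2 for
  -- replacing `t` by `t / 2`, and `m` is the surplus that survives.
  obtain ⟨n, x, hx⟩ : ∃ (n : ℕ) (x : Fin n → F),
      m * 2 * 2 ^ m * ‖latticePowerSum r x‖ < (∑ k, ‖x k‖ ^ r) ^ (1 / r) := by
    by_contra! h
    exact hF ⟨m * 2 * 2 ^ m, by positivity, h⟩
  obtain ⟨N, w, t, hw0, hwu, hwx, ht⟩ := exists_decomposition_latticePowerSum hr x
  set u := latticePowerSum r x with hu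
  have hu0 : 0 < ‖u‖ := by
    refine (norm_nonneg u).lt_of_ne' fun h0 => ?_
    have hxk : ∀ k, x k = 0 := fun k => by
      have := norm_le_norm_of_abs_le_abs
        ((abs_le_latticePowerSum hr0 x k).trans (le_abs_self _))
      exact norm_le_zero_iff.1 (this.trans h0.le)
    simp [hxk, h0, hr0.ne'] at hx
  set s : ℝ := 1 / (2 ^ m * ‖u‖) with hs
  have hs0 : 0 < s := by positivity
  refine ⟨N, fun i => s • w i, fun i => smul_nonneg hs0.le (hw0 i), ?_, n,
    fun k i => t k i / 2, fun i => ?_, ?_⟩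
  · rw [← Finset.smul_sum, hwu, norm_smul, Real.norm_of_nonneg hs0.le, hs, one_div_pow]
    apply le_of_eq
    field_simp
  · have : ∀ k, |t k i / 2| ^ r = |t k i| ^ r / 2 ^ r := fun k => by
      rw [abs_div, abs_two, Real.div_rpow (abs_nonneg _) zero_le_two]
    simp_rw [this, ← Finset.sum_div]
    rw [div_le_one (by positivity)]
    exact ht i
  · have h1 : ∀ k, ∑ i, (t k i / 2) • s • w i = (s / 2) • x k := fun k => by
      rw [← hwx, Finset.smul_sum]
      exact Finset.sum_congr rfl fun i _ => by module
    have hs2 : 0 ≤ s / 2 := by positivity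
    have hS : 0 ≤ ∑ k, ‖x k‖ ^ r :=
      Finset.sum_nonneg fun k _ => Real.rpow_nonneg (norm_nonneg _) r
    have h2 : (∑ k, ‖∑ i, (t k i / 2) • s • w i‖ ^ r) ^ (1 / r) =
        s / 2 * (∑ k, ‖x k‖ ^ r) ^ (1 / r) := by
      simp_rw [h1, norm_smul, Real.norm_of_nonneg hs2, Real.mul_rpow hs2 (norm_nonneg _)]
      rw [← Finset.mul_sum, Real.mul_rpow (by positivity) hS, ← Real.rpow_mul hs2,
        mul_one_div_cancel hr0.ne', Real.rpow_one]
    rw [h2]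
    refine lt_of_eq_of_lt ?_ (mul_lt_mul_of_pos_left hx (half_pos hs0))
    rw [hs]
    field_simp

theorem exists_operator_of_not_isRConcaveLattice {r : ℝ} (hr : 1 ≤ r)
    (hF : ¬ IsRConcaveLattice r F) :
    ∃ (Ω : Type v) (_ : MeasurableSpace Ω) (μ : Measure Ω) (_ : SigmaFinite μ) (_ : μ.IsComplete)
      (T : Lp ℝ ⊤ μ →L[ℝ] F), (∀ f, 0 ≤ f → 0 ≤ T f) ∧
      ∀ m : ℕ, ∃ (n : ℕ) (x : Fin n → Lp ℝ ⊤ μ), (∀ᵐ ω ∂μ, ∑ k, |x k ω| ^ r ≤ 1) ∧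
        m < (∑ k, ‖T (x k)‖ ^ r) ^ (1 / r) := by
  classical
  have hr0 : 0 < r := one_pos.trans_le hr
  choose N w hw0 hw1 n t ht hlt using exists_block_of_not_isRConcaveLattice hr hF
  -- The disjoint union of all blocks with counting measure: null sets are empty, so classes are
  -- genuine functions. The lift serves an arbitrary universe.
  let Ω := ULift.{v} (Σ m, Fin (N m))
  let e : Ω ≃ Σ m, Fin (N m) := Equiv.ulift
  let _ : MeasurableSpace Ω := ⊤
  have : DiscreteMeasurableSpace Ω := ⟨fun _ => trivial⟩
  have : Countable Ω := e.countable_iff.2 inferInstance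
  obtain ⟨T, hT0, hT⟩ := exists_block_operator w hw0
    (.of_nonneg_of_le (fun m => norm_nonneg _) hw1 summable_geometric_two) e
  refine ⟨Ω, inferInstance, Measure.count, inferInstance, ⟨fun s _ => .of_discrete⟩, T, hT0,
    fun m => ?_⟩
  -- The test functions of block `m`, extended by 0 to the other blocks.
  let h : Fin (n m) → Ω → ℝ := fun k ω =>
    if hω : (e ω).1 = m then t m k (Fin.cast (congrArg N hω) (e ω).2) else 0
  have hsum : ∀ ω, ∑ k, |h k ω| ^ r ≤ 1 := fun ω => by
    by_cases hω : (e ω).1 = m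
    · simpa [h, hω] using ht m _
    · simp [h, hω, hr0.ne']
  have hmem : ∀ k, MemLp (h k) ⊤ (Measure.count : Measure Ω) := fun k => by
    refine memLp_top_of_bound (Measurable.of_discrete.aestronglyMeasurable) 1 (.of_forall fun ω => ?_)
    refine (abs_apply_le_rpow_sum hr0 (fun k => h k ω) k).trans ?_
    exact Real.rpow_le_one (Finset.sum_nonneg fun k _ => Real.rpow_nonneg (abs_nonneg _) r)
      (hsum ω) (by positivity)
  have hcoe : ∀ k ω, (hmem k).toLp (h k) ω = h k ω := fun k =>
    Measure.ae_count_iff.1 (hmem k).coeFn_toLp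
  refine ⟨n m, fun k => (hmem k).toLp (h k), .of_forall fun ω => ?_, ?_⟩
  · simpa only [hcoe] using hsum ω
  · convert hlt m using 5 with k
    rw [hT _ m fun ω hω => by rw [hcoe]; simp [h, hω]]
    refine Finset.sum_congr rfl fun i _ => ?_
    have hi : h k (e.symm ⟨m, i⟩) = t m k i := dif_pos rfl
    rw [hcoe, hi]

end BlockOperator

/-! ### The implications between the three conditions -/

section Equivalences

variable {F : Type u} [NormedAddCommGroup F] [NormedSpace ℝ F] [CompleteSpace F]
    [Lattice F] [IsOrderedAddMonoid F] [IsOrderedModule ℝ F] [HasSolidNorm F]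

theorem IsRConcaveLattice.isRConcaveOperator {r : ℝ} (hF : IsRConcaveLattice r F) {X : Type*}
    [NormedAddCommGroup X] [NormedSpace ℝ X] [CompleteSpace X] [Lattice X] [IsOrderedAddMonoid X]
    [IsOrderedModule ℝ X] [HasSolidNorm X] (T : X →L[ℝ] F) (hT : ∀ x, 0 ≤ x → 0 ≤ T x) :
    IsRConcaveOperator r T := by
  obtain ⟨c, hc0, hc⟩ := hF
  refine ⟨c * ‖T‖, by positivity, fun n x => (hc n fun k => T (x k)).trans ?_⟩
  have hle : latticePowerSum r (fun k => T (x k)) ≤ T (latticePowerSum r x) := by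
    refine latticePowerSum_le _ fun a ha => ?_
    simp_rw [← map_smul, ← map_sum]
    rw [← sub_nonneg, ← map_sub]
    exact hT _ (sub_nonneg.2 (sum_smul_le_latticePowerSum x ha))
  have h0 := latticePowerSum_nonneg r (fun k => T (x k))
  rw [mul_assoc]
  refine mul_le_mul_of_nonneg_left ((norm_le_norm_of_abs_le_abs ?_).trans (T.le_opNorm _)) hc0
  rwa [abs_of_nonneg h0, abs_of_nonneg (h0.trans hle)]

theorem norm_latticePowerSum_Lp_top_le_one {r : ℝ} (hr : 0 < r) {Ω : Type*} [MeasurableSpace Ω]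
    {μ : Measure Ω} {n : ℕ} (x : Fin n → Lp ℝ ⊤ μ) (hx : ∀ᵐ ω ∂μ, ∑ k, |x k ω| ^ r ≤ 1) :
    ‖latticePowerSum r x‖ ≤ 1 := by
  have h1 : MemLp (fun _ : Ω => (1 : ℝ)) ⊤ μ := memLp_top_const 1
  have hle : latticePowerSum r x ≤ h1.toLp _ := by
    refine latticePowerSum_le _ fun a ha => ?_
    rw [← Lp.coeFn_le]
    have h2 : ∀ᵐ ω ∂μ, ∀ k, (a k • x k : Lp ℝ ⊤ μ) ω = a k * x k ω :=
      ae_all_iff.2 fun k => Lp.coeFn_smul (a k) (x k)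
    filter_upwards [hx, h2, Lp.coeFn_finsetSum Finset.univ (fun k => a k • x k),
      h1.coeFn_toLp] with ω h3 h4 h5 h6
    rw [h5, h6]
    simp only [Finset.sum_apply, h4]
    refine (ha fun k => x k ω).trans ?_
    exact Real.rpow_le_one (Finset.sum_nonneg fun k _ => Real.rpow_nonneg (abs_nonneg _) r)
      h3 (by positivity)
  have h0 := latticePowerSum_nonneg r x
  refine (norm_le_norm_of_abs_le_abs (b := h1.toLp _) ?_).trans (Lp_top_norm_le zero_le_one ?_)
  · rwa [abs_of_nonneg h0, abs_of_nonneg (h0.trans hle)]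
  · filter_upwards [h1.coeFn_toLp] with ω hω
    rw [hω, abs_one]

theorem isRConcaveLattice_of_isRConcaveOperator {r : ℝ} (hr : 1 ≤ r)
    (h : ∀ (X : Type v) [NormedAddCommGroup X] [NormedSpace ℝ X] [CompleteSpace X]
      [Lattice X] [IsOrderedAddMonoid X] [IsOrderedModule ℝ X] [HasSolidNorm X]
      (T : X →L[ℝ] F), (∀ x : X, 0 ≤ x → 0 ≤ T x) → IsRConcaveOperator r T) :
    IsRConcaveLattice r F := by
  by_contra hF
  obtain ⟨Ω, _, μ, _, _, T, hT0, hT⟩ := exists_operator_of_not_isRConcaveLattice.{v} hr hF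
  obtain ⟨c, hc0, hc⟩ := h (Lp ℝ ⊤ μ) T hT0
  obtain ⟨m, hm⟩ := exists_nat_ge c
  obtain ⟨n, x, hx, hlt⟩ := hT m
  have h1 := norm_latticePowerSum_Lp_top_le_one (one_pos.trans_le hr) x hx
  have h2 := (hc n x).trans (mul_le_of_le_one_right hc0 h1)
  linarith

/-- For functions on `L_∞` with `∑ |x k|^r ≤ 1`, additivity and positivity of `φ` give `∑ ‖T (x
k)‖^r ≤ φ(∑ |x k|^r) ≤ φ(1)`. The block operator admits no such uniform bound. -/
theorem isRConcaveLattice_of_isPowerDominated {r : ℝ} (hr : 1 ≤ r)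
    (h : ∀ (Ω : Type w) [MeasurableSpace Ω] (μ : Measure Ω) [SigmaFinite μ] [μ.IsComplete]
      (X : BanachFunctionSpace μ), X.IsRConvex r →
      ∀ T : X.carrier →ₗ[ℝ] F, X.IsPositiveOperator T →
        X.IsPowerDominated r (zero_lt_one.trans_le hr) T) :
    IsRConcaveLattice r F := by
  have hr0 : 0 < r := one_pos.trans_le hr
  by_contra hF
  obtain ⟨Ω, _, μ, _, _, T, hT0, hT⟩ := exists_operator_of_not_isRConcaveLattice.{w} hr hF
  let X := linftySpace μ
  let T' : X.carrier →ₗ[ℝ] F :=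
    { toFun := fun x => T ⟨x.1, x.2⟩
      map_add' := fun x y => T.map_add ⟨x.1, x.2⟩ ⟨y.1, y.2⟩
      map_smul' := fun c x => T.map_smul c ⟨x.1, x.2⟩ }
  obtain ⟨φ, hφ0, -, hφ⟩ := h Ω μ X (linftySpace_isRConvex hr0) T'
    ⟨⟨‖T‖, fun x => T.le_opNorm ⟨x.1, x.2⟩⟩, fun x hx => hT0 ⟨x.1, x.2⟩ hx⟩
  have h1 : MemLp (fun _ : Ω => (1 : ℝ)) ⊤ μ := memLp_top_const 1
  let one : X.carrier := ⟨(h1.toLp _).1, (h1.toLp _).2⟩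
  obtain ⟨m, hm⟩ := exists_nat_ge ((φ (X.toPower r hr0 one)) ^ (1 / r))
  obtain ⟨n, x, hx, hlt⟩ := hT m
  let x' : Fin n → X.carrier := fun k => ⟨(x k).1, (x k).2⟩
  have hpos : ∀ k, 0 ≤ φ (X.toPower r hr0 (x' k)) := fun k => hφ0 _ (absPow_nonneg _ _)
  have hk : ∀ k, ‖T (x k)‖ ^ r ≤ φ (X.toPower r hr0 (x' k)) := fun k => by
    have := Real.rpow_le_rpow (norm_nonneg _) (hφ (x' k)) hr0.le
    rwa [← Real.rpow_mul (hpos k), one_div_mul_cancel hr0.ne', Real.rpow_one] at this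
  have hle : ∑ k, X.toPower r hr0 (x' k) ≤ X.toPower r hr0 one := by
    rw [← Subtype.coe_le_coe, ← AEEqFun.coeFn_le, AddSubmonoidClass.coe_finsetSum]
    have h2 : ∀ᵐ ω ∂μ, ∀ k, absPow r (x k : Ω →ₘ[μ] ℝ) ω = |x k ω| ^ r :=
      ae_all_iff.2 fun k => coeFn_absPow r _
    filter_upwards [hx, h2, AEEqFun.coeFn_finsetSum Finset.univ
      (fun k => (X.toPower r hr0 (x' k) : Ω →ₘ[μ] ℝ)), h1.coeFn_toLp,
      coeFn_absPow r (h1.toLp _ : Lp ℝ ⊤ μ).1] with ω h3 h4 h5 h6 h7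
    rw [h5]
    change _ ≤ absPow r (h1.toLp _ : Lp ℝ ⊤ μ).1 ω
    rw [h7]
    change _ ≤ |(h1.toLp _ : Lp ℝ ⊤ μ) ω| ^ r
    rw [h6, abs_one, Real.one_rpow, Finset.sum_apply]
    exact (Finset.sum_le_sum fun k _ => (h4 k).le).trans h3
  have hsum : ∑ k, ‖T (x k)‖ ^ r ≤ φ (X.toPower r hr0 one) := by
    refine (Finset.sum_le_sum fun k _ => hk k).trans ?_
    rw [← map_sum, ← sub_nonneg, ← map_sub]
    exact hφ0 _ (sub_nonneg.2 hle)
  have := Real.rpow_le_rpow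
    (Finset.sum_nonneg fun k _ => Real.rpow_nonneg (norm_nonneg _) r) hsum
    (by positivity : 0 ≤ 1 / r)
  linarith

end Equivalences

theorem corollary7 {F : Type u} [NormedAddCommGroup F] [NormedSpace ℝ F] [CompleteSpace F]
    [Lattice F] [IsOrderedAddMonoid F] [IsOrderedModule ℝ F] [HasSolidNorm F]
    (r : ℝ) (hr : 1 ≤ r) :
    List.TFAE
      [IsRConcaveLattice r F,
       ∀ (X : Type v) [NormedAddCommGroup X] [NormedSpace ℝ X] [CompleteSpace X]
         [Lattice X] [IsOrderedAddMonoid X] [IsOrderedModule ℝ X] [HasSolidNorm X]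
         (T : X →L[ℝ] F), (∀ x : X, 0 ≤ x → 0 ≤ T x) → IsRConcaveOperator r T,
       ∀ (Ω : Type w) [MeasurableSpace Ω] (μ : Measure Ω) [SigmaFinite μ] [μ.IsComplete]
         (X : BanachFunctionSpace μ), X.IsRConvex r →
         ∀ T : X.carrier →ₗ[ℝ] F, X.IsPositiveOperator T →
           X.IsPowerDominated r (zero_lt_one.trans_le hr) T] := by
  tfae_have 1 → 2 := by
    intro hF X _ _ _ _ _ _ _ T hT
    exact hF.isRConcaveOperator T hT
  tfae_have 2 → 1 := isRConcaveLattice_of_isRConcaveOperator hr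
  tfae_have 1 → 3 := by
    intro hF Ω _ μ _ _ X hX T hT
    exact hT.isPowerDominated _ hF hX
  tfae_have 3 → 1 := isRConcaveLattice_of_isPowerDominated hr
  tfae_finish
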